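/- **Problem.** There are $n$ independent arms. Arm $i$ has a hidden state in $\{g,b\}$ which moves from $b$ to $g$ with probability $\alpha_i>0$ and from $g$ to $b$ with probability $\beta_i>0$ in every time step, whether or not the arm is played; $\alpha_i+\beta_i<1$. In every time step at most $M\ge 1$ arms are played. A play of arm $i$ earns $r_i\ge 0$ if its state is $g$ and $0$ otherwise; the reward is banked and reveals nothing. At the end of the time step, before the states evolve, the player may probe arms, one after the other; a probe of arm $i$ costs $c_i\ge 0$ and reveals its current state. Policies may be randomized and depend on the history of plays and probe outcomes. At the start the state of every arm has just been observed. The value of a policy is its long-run expected time average of rewards minus probing costs, and $OPT$ is the supremum of the values (as upper limits) over all policies and start states. **Balanced linear programs.** Let $v_{it}=\frac{\alpha_i}{\alpha_i+\beta_i}(1-(1-\alpha_i-\beta_i)^t)$ and $u_{it}=\frac{\alpha_i}{\alpha_i+\beta_i}+\frac{\beta_i}{\alpha_i+\beta_i}(1-\alpha_i-\beta_i)^t$ be the probabilities that arm $i$ is in state $g$ when it was observed in state $b$, respectively $g$, $t$ steps ago, and let $R^i_{gt}=r_iu_{it}$, $R^i_{bt}=r_iv_{it}$. For a horizon $T$ the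 balanced dual is: minimize $M\lambda+\sum_i h_i$ over $\lambda,h_i,p_i,\phi^i_{st}\ge 0$ ($1\le t\le T$, $s\in\{g,b\}$) subject to $$\lambda+\phi^i_{st}\ge R^i_{st},\qquad th_i\ge -c_i-(1-u_{it})p_i+\sum_{l\le t}\phi^i_{gl},\qquad th_i\ge -c_i+v_{it}p_i+\sum_{l\le t}\phi^i_{bl},\qquad M\lambda=\sum_i h_i .$$ The corresponding primal is: maximize $\sum_i\sum_{t\le T}\bigl(r_i(u_{it}x^i_{gt}+v_{it}x^i_{bt})-c_i(z^i_{gt}+z^i_{bt})\bigr)$ over $x^i_{st},z^i_{st}\ge 0$ and $\omega\in\mathbb{R}$ subject to $$\sum_{i}\sum_{t\le T}(x^i_{gt}+x^i_{bt})\le M(1-\omega),\quad \sum_{t\le T} t(z^i_{gt}+z^i_{bt})\le 1+\omega,\quad x^i_{st}\le\sum_{t\le l\le T}z^i_{sl},\quad \sum_{t\le T}(1-u_{it})z^i_{gt}=\sum_{t\le T}v_{it}z^i_{bt}.$$ **Policy.** Given optimal solutions of both programs, let $S=\{i: h_i>0\}$ and, for $i\in S$, $d_i=\min\{t: z^i_{bt}>0\}$,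 $e_i=\min\{t: z^i_{gt}>0\}$ and $m_i=|\{l\le d_i:\phi^i_{bl}>0\}|$. Only arms in $S$ are used. An arm observed in state $b$ is not ready for $d_i-m_i$ steps and ready afterwards. *Stage 1 (try)*, for a ready arm: play it for $m_i$ steps and probe it at the end of the last of them (if $m_i=0$, probe it at once, at the end of the time step just completed); if the state is $g$, go to Stage 2. *Stage 2 (exploit)*, for an arm just observed in state $g$: play it for $e_i$ steps and probe it at the end of the last of them; if the state is $g$, repeat Stage 2. The policy keeps initiating Stage 1 with ready arms, in any order, as long as fewer than $M$ arms are in the two stages. It starts from any observed states in which at most $M$ arms of $S$ are in state $g$ (these start in Stage 2). **Theorem.** For every instance and every $\epsilon>0$ there is $T_0$ such that for every $T\ge T_0$: both programs with horizon $T$ have optimal solutions; for all such optimal solutions the parameters $d_i,e_i$ ($i\in S$) are well defined and the policy can be executed; and every execution of the policy has time-average value (as a lower limit) at least $OPT/(2+\epsilon)$, where $OPT<\infty$. That is, the policy is a $(2+\epsilon)$-approximation to Feedback MAB with observation costs. -/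

import Mathlib

open Filter Finset

noncomputable section

/-- An instance with `n` independent two-state arms (`true` is the good state `g`, `false` the bad
state `b`).  An arm moves from `b` to `g` with probability `α` and from `g` to `b` with probability
`β`, whether or not it is played; `r` is the reward of a play in state `g` (a play in state `b`
earns nothing) and `c` is the cost of a probe. -/
structure ProbeBandit (n : ℕ) where
  α : Fin n → ℝ
  β : Fin n → ℝ
  r : Fin n → ℝ
  c : Fin n → ℝ
  α_pos : ∀ i, 0 < α i
  β_pos : ∀ i, 0 < β i
  bursty : ∀ i, α i + β i < 1
  r_nonneg : ∀ i, 0 ≤ r i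
  c_nonneg : ∀ i, 0 ≤ c i

/-- What the player can see: the set of arms that was played in a time step (nothing is revealed
about their rewards or states), and the outcome of a probe. -/
inductive Event (n : ℕ) where
  | played (A : Finset (Fin n)) : Event n
  | probed (i : Fin n) (good : Bool) : Event n

/-- Histories list the events, the most recent one first. -/
abbrev History (n : ℕ) := List (Event n)

/-- A (randomized, history dependent) policy that plays at most `M` arms per time step.
`play` chooses the arms played in a time step.  At the end of the time step the player probes arms
one after the other: `probe` chooses the next arm to probe, or `none` to finish the time step. -/
structure Policy (n M : ℕ) where
  play : History n → PMF (Finset (Fin n))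
  probe : History n → PMF (Option (Fin n))
  card_le : ∀ h, ∀ A ∈ (play h).support, A.card ≤ M

namespace ProbeBandit

variable {n : ℕ} (I : ProbeBandit n)

/-! ### The decision problem -/

/-- One-step transition probability of the joint hidden state; the arms are independent. -/
def trans (s s' : Fin n → Bool) : ℝ :=
  ∏ i, match s i, s' i with
    | false, true => I.α i
    | false, false => 1 - I.α i
    | true, false => I.β i
    | true, true => 1 - I.β i

/-- Expected value collected from the probing part of a time step on, when the hidden state during
the time step is `s`, the history is `h`, at most `k` further probes can be made in this time step,
and `cont` is the value collected after the time step. -/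
def probeValue {M : ℕ} (π : Policy n M) (s : Fin n → Bool) (cont : History n → ℝ) :
    ℕ → History n → ℝ
  | 0, h => cont h
  | k + 1, h => ∑ o : Option (Fin n), (π.probe h o).toReal *
      match o with
      | none => cont h
      | some i => -I.c i + probeValue π s cont k (Event.probed i (s i) :: h)

/-- Expected value (rewards minus probing costs) of the next `k` time steps, when the history is
`h` and the hidden state at the start of the next time step is `s`.  In a time step with hidden
state `s` the player plays, then makes up to `n` probes (enough to probe each arm once), which
reveal `s`; then the hidden state evolves. -/
def valueToGo {M : ℕ} (π : Policy n M) : ℕ → History n → (Fin n → Bool) → ℝ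
  | 0, _, _ => 0
  | k + 1, h, s => ∑ A : Finset (Fin n), (π.play h A).toReal *
      ((∑ i ∈ A, if s i then I.r i else 0) +
        I.probeValue π s (fun h' => ∑ s', I.trans s s' * valueToGo π k h' s') n
          (Event.played A :: h))

/-- Expected time-average value of the first `k` time steps, when the arms were all observed, in
the states `s₀`, at the end of the time step before the first one. -/
def averageValue {M : ℕ} (π : Policy n M) (s₀ : Fin n → Bool) (k : ℕ) : ℝ :=
  (∑ s, I.trans s₀ s * I.valueToGo π k [] s) / k

/-- Long-run time-average values, over all policies and all start states (upper limits). -/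
def achievableValues (M : ℕ) : Set ℝ :=
  {w | ∃ (π : Policy n M) (s₀ : Fin n → Bool), w = limsup (I.averageValue π s₀) atTop}

/-- The value of the optimal policy. -/
def optimalValue (M : ℕ) : ℝ := sSup (I.achievableValues M)

/-- The long-run time-average value that a policy guarantees (lower limit). -/
def guaranteedValue {M : ℕ} (π : Policy n M) (s₀ : Fin n → Bool) : ℝ :=
  liminf (I.averageValue π s₀) atTop

/-! ### The balanced linear program and its dual -/

/-- Probability that arm `i` is good when it was observed to be bad `t` steps ago. -/
def v (i : Fin n) (t : ℕ) : ℝ :=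
  I.α i / (I.α i + I.β i) * (1 - (1 - I.α i - I.β i) ^ t)

/-- Probability that arm `i` is good when it was observed to be good `t` steps ago. -/
def u (i : Fin n) (t : ℕ) : ℝ :=
  I.α i / (I.α i + I.β i) + I.β i / (I.α i + I.β i) * (1 - I.α i - I.β i) ^ t

/-- Expected reward of playing arm `i` when it was observed in state `s` exactly `t` steps ago. -/
def R (i : Fin n) (s : Bool) (t : ℕ) : ℝ :=
  I.r i * (if s then I.u i t else I.v i t)

/-- Variables of the balanced dual; only the `φ i s t` with `1 ≤ t ≤ T` matter. -/
structure DualPoint (n : ℕ) where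
  lam : ℝ
  h : Fin n → ℝ
  p : Fin n → ℝ
  φ : Fin n → Bool → ℕ → ℝ

/-- Variables of the balanced primal; only the entries with `1 ≤ t ≤ T` matter.  `ω` is the
multiplier of the balance constraint of the dual. -/
structure PrimalPoint (n : ℕ) where
  x : Fin n → Bool → ℕ → ℝ
  z : Fin n → Bool → ℕ → ℝ
  ω : ℝ

/-- Feasibility in the balanced dual with times restricted to `1 ≤ t ≤ T`. -/
structure DualFeasible (M T : ℕ) (D : DualPoint n) : Prop where
  lam_nonneg : 0 ≤ D.lam
  h_nonneg : ∀ i, 0 ≤ D.h i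
  p_nonneg : ∀ i, 0 ≤ D.p i
  φ_nonneg : ∀ i s, ∀ t ∈ Icc 1 T, 0 ≤ D.φ i s t
  play : ∀ i s, ∀ t ∈ Icc 1 T, I.R i s t ≤ D.lam + D.φ i s t
  good : ∀ i, ∀ t ∈ Icc 1 T,
    -I.c i - (1 - I.u i t) * D.p i + ∑ l ∈ Icc 1 t, D.φ i true l ≤ t * D.h i
  bad : ∀ i, ∀ t ∈ Icc 1 T,
    -I.c i + I.v i t * D.p i + ∑ l ∈ Icc 1 t, D.φ i false l ≤ t * D.h i
  balance : M * D.lam = ∑ i, D.h i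

def dualObjective (M : ℕ) (D : DualPoint n) : ℝ := M * D.lam + ∑ i, D.h i

def DualOptimal (M T : ℕ) (D : DualPoint n) : Prop :=
  I.DualFeasible M T D ∧
    ∀ D', I.DualFeasible M T D' → dualObjective M D ≤ dualObjective M D'

/-- Feasibility in the balanced primal with times restricted to `1 ≤ t ≤ T`. -/
structure PrimalFeasible (M T : ℕ) (P : PrimalPoint n) : Prop where
  x_nonneg : ∀ i s, ∀ t ∈ Icc 1 T, 0 ≤ P.x i s t
  z_nonneg : ∀ i s, ∀ t ∈ Icc 1 T, 0 ≤ P.z i s t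
  plays : ∑ i, ∑ t ∈ Icc 1 T, (P.x i true t + P.x i false t) ≤ M * (1 - P.ω)
  time : ∀ i, ∑ t ∈ Icc 1 T, t * (P.z i true t + P.z i false t) ≤ 1 + P.ω
  play_le : ∀ i s, ∀ t ∈ Icc 1 T, P.x i s t ≤ ∑ l ∈ Icc t T, P.z i s l
  flow : ∀ i, ∑ t ∈ Icc 1 T, (1 - I.u i t) * P.z i true t =
    ∑ t ∈ Icc 1 T, I.v i t * P.z i false t

def primalObjective (T : ℕ) (P : PrimalPoint n) : ℝ :=
  ∑ i, ∑ t ∈ Icc 1 T, (I.r i * (I.u i t * P.x i true t + I.v i t * P.x i false t) -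
    I.c i * (P.z i true t + P.z i false t))

def PrimalOptimal (M T : ℕ) (P : PrimalPoint n) : Prop :=
  I.PrimalFeasible M T P ∧
    ∀ P', I.PrimalFeasible M T P' → I.primalObjective T P' ≤ I.primalObjective T P

end ProbeBandit

/-! ### The two-stage policy -/

/-- The parameters of the policy: the arms `S` that it uses and, for each arm, `d`, `e` and `m`. -/
structure StageParams (n : ℕ) where
  S : Finset (Fin n)
  d : Fin n → ℕ
  e : Fin n → ℕ
  m : Fin n → ℕ

/-- The parameters that a primal and a dual solution define: `S` is the set of arms with `h i > 0`,
`d i` and `e i` are the smallest times `t` with `z i false t > 0` and `z i true t > 0`, and `m i`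
is the number of times `l ≤ d i` with `φ i false l > 0`. -/
def stageParams {n : ℕ} (T : ℕ) (P : ProbeBandit.PrimalPoint n) (D : ProbeBandit.DualPoint n) :
    StageParams n where
  S := {i | 0 < D.h i}
  d i := sInf {t | t ∈ Icc 1 T ∧ 0 < P.z i false t}
  e i := sInf {t | t ∈ Icc 1 T ∧ 0 < P.z i true t}
  m i := #{l ∈ Icc 1 (sInf {t | t ∈ Icc 1 T ∧ 0 < P.z i false t}) | 0 < D.φ i false l}

/-- The situation of an arm in the policy: `waiting y` means that it is in neither stage and `y`
time steps have passed since it was observed to be bad; `trying j` (`exploiting j`) means that it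
is in Stage 1 (Stage 2) and has been played `j` times in this stage. -/
inductive Phase where
  | waiting (y : ℕ) : Phase
  | trying (j : ℕ) : Phase
  | exploiting (j : ℕ) : Phase

/-- The phase of an arm after a history.  An arm in a stage is played in every time step until it
is probed, so that a play increases the counter. -/
def phase {n : ℕ} (s₀ : Fin n → Bool) : History n → Fin n → Phase
  | [], i => if s₀ i then .exploiting 0 else .waiting 0
  | .played A :: h, i =>
    match phase s₀ h i with
    | .waiting y => if i ∈ A then .trying 1 else .waiting (y + 1)
    | .trying j => .trying (j + 1)
    | .exploiting j => .exploiting (j + 1)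
  | .probed a good :: h, i =>
    if i = a then (if good then .exploiting 0 else .waiting 0) else phase s₀ h i

namespace StageParams

variable {n : ℕ} (q : StageParams n) (s₀ : Fin n → Bool)

open Classical in
/-- The arms that are in Stage 1 or Stage 2. -/
def busy (h : History n) : Finset (Fin n) :=
  {i ∈ q.S | ∃ j, phase s₀ h i = .trying j ∨ phase s₀ h i = .exploiting j}

open Classical in
/-- The arms in neither stage that are ready: `d - m` steps have passed since they were observed
to be bad. -/
def ready (h : History n) : Finset (Fin n) :=
  {i ∈ q.S | ∃ y, phase s₀ h i = .waiting y ∧ q.d i - q.m i ≤ y}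

/-- Arm `i` has completed the plays of its stage, so that it has to be probed now. -/
def Due (h : History n) (i : Fin n) : Prop :=
  i ∈ q.S ∧ (phase s₀ h i = .trying (q.m i) ∨ phase s₀ h i = .exploiting (q.e i))

/-- Choice of the arms to play in a time step: all the arms in a stage, and ready arms for which
Stage 1 starts with a play (arms with `m i > 0`).  If fewer than `M` arms are played, no ready arm
is left over. -/
def PlayRule (M : ℕ) (h : History n) (A : Finset (Fin n)) : Prop :=
  q.busy s₀ h ⊆ A ∧
  (∀ i ∈ A, i ∉ q.busy s₀ h → i ∈ q.ready s₀ h ∧ 0 < q.m i) ∧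
  (A.card < M → q.ready s₀ h ⊆ A)

/-- Choice of the next probe at the end of a time step.  An arm is probed if it is due, or if it is
ready, `m i = 0`, and fewer than `M` arms are in a stage: Stage 1 of such an arm consists of the
probe alone.  The time step can end when no arm is due. -/
def ProbeRule (M : ℕ) (h : History n) : Option (Fin n) → Prop
  | some i => q.Due s₀ h i ∨ (i ∈ q.ready s₀ h ∧ q.m i = 0 ∧ (q.busy s₀ h).card < M)
  | none => ∀ i, ¬ q.Due s₀ h i

end StageParams

/-- Decision points that a policy can reach: `Visits π none h` if it can have to choose the plays of
a time step with history `h`, and `Visits π (some k) h` if it can be at the end of a time step with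
history `h` and `k` probes left. -/
inductive Visits {n M : ℕ} (π : Policy n M) : Option ℕ → History n → Prop
  | start : Visits π none []
  | play {h : History n} {A : Finset (Fin n)} :
      Visits π none h → A ∈ (π.play h).support → Visits π (some n) (.played A :: h)
  | probe {k : ℕ} {h : History n} {i : Fin n} (good : Bool) :
      Visits π (some (k + 1)) h → some i ∈ (π.probe h).support →
        Visits π (some k) (.probed i good :: h)
  | finish {k : ℕ} {h : History n} :
      Visits π (some (k + 1)) h → none ∈ (π.probe h).support → Visits π none h
  | last {h : History n} : Visits π (some 0) h → Visits π none h

/-- `π` is an execution of the two-stage policy with parameters `q`: all its decisions obey the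
rules.  Which ready arms get the free places is left open. -/
def IsTwoStage {n M : ℕ} (q : StageParams n) (s₀ : Fin n → Bool) (π : Policy n M) : Prop :=
  (∀ h, Visits π none h → ∀ A ∈ (π.play h).support, q.PlayRule s₀ M h A) ∧
  (∀ k h, Visits π (some (k + 1)) h → ∀ o ∈ (π.probe h).support, q.ProbeRule s₀ M h o)

end

/-!
The prices `λ`, `h`, `p` and `φ` of a dual point turn every history into a potential: an arm that
was observed in state `s`, `t` steps ago, has potential `t h_i - ∑_{l ≤ t} φ_{sl}`, plus `p_i` if
`s = g`. In one time step this changes by `h_i - φ`, while a play earns at most `λ + φ`, and the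
constraints at time `t` say that a probe after `t` steps does not pay. Hence every policy earns at
most `M λ + ∑ h_i` per step. The constraints are only given for `t ≤ T`; raising `h_i` by
`(c_i + p_i) / T` makes them hold for all `t`, and `p_i` is bounded in terms of `h_i`, so that this
is absorbed by `ε`.

For an optimal dual point, complementary slackness makes the probe constraints at `d_i` and `e_i`
tight. The two-stage policy then has a potential of bounded size for which a step brings `λ` for
every play and `h_i` for every arm of `S` that is not left over ready. Either `M` arms are played,
or no ready arm is left over, so that a step brings at least `M λ` or at least `∑ h_i`. The balance
`M λ = ∑ h_i` makes both equal to half of the dual objective.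
-/

noncomputable section

section LinearProgramming

variable {𝕜 V J : Type*} [Field 𝕜] [LinearOrder 𝕜] [IsStrictOrderedRing 𝕜]
  [AddCommGroup V] [Module 𝕜 V]

theorem eq_add_smul_of_comp_projection_eq {a c g : V →ₗ[𝕜] 𝕜} {z : V} (hz : a z ≠ 0)
    (h : ∀ x, c (x - (a x / a z) • z) = g (x - (a x / a z) • z)) :
    c = g + ((c z - g z) / a z) • a := by
  ext x
  have hx := h x
  simp only [map_sub, map_smul, smul_eq_mul] at hx
  simp only [LinearMap.add_apply, LinearMap.smul_apply, smul_eq_mul]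
  field_simp at hx ⊢
  linear_combination hx

/-- The induction eliminates one functional `a k`: if `c` is negative at some `z` in the cone of
the other functionals, then `a k z < 0`, and projecting along `z` onto the kernel of `a k` reduces
the claim to the other functionals. -/
theorem farkas (s : Finset J) (a : J → V →ₗ[𝕜] 𝕜) (c : V →ₗ[𝕜] 𝕜)
    (h : ∀ x, (∀ j ∈ s, 0 ≤ a j x) → 0 ≤ c x) :
    ∃ w : J → 𝕜, (∀ j, 0 ≤ w j) ∧ c = ∑ j ∈ s, w j • a j := by
  classical
  induction s using Finset.induction_on generalizing a c with
  | empty =>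
    refine ⟨0, fun _ => le_rfl, LinearMap.ext fun x => le_antisymm ?_ (h x (by simp))⟩
    simpa using h (-x) (by simp)
  | insert k s hk ih =>
    suffices ∃ w : J → 𝕜, (∀ j, 0 ≤ w j) ∧ ∃ μ : 𝕜, 0 ≤ μ ∧ c = ∑ j ∈ s, w j • a j + μ • a k by
      obtain ⟨w, hw, μ, hμ, rfl⟩ := this
      refine ⟨Function.update w k μ, fun j => ?_, ?_⟩
      · rcases eq_or_ne j k with rfl | hj <;> simp [*]
      · rw [sum_insert hk, Function.update_self, add_comm]
        refine congrArg _ (sum_congr rfl fun j hj => ?_)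
        rw [Function.update_of_ne (ne_of_mem_of_not_mem hj hk)]
    by_cases hs : ∀ x, (∀ j ∈ s, 0 ≤ a j x) → 0 ≤ c x
    · obtain ⟨w, hw, hc⟩ := ih a c hs
      exact ⟨w, hw, 0, le_rfl, by rw [zero_smul, add_zero, ← hc]⟩
    push Not at hs
    obtain ⟨z, hz, hcz⟩ := hs
    have hkz : a k z < 0 := by
      by_contra! hkz
      exact hcz.not_ge (h z (forall_mem_insert .. |>.2 ⟨hkz, hz⟩))
    let proj : V →ₗ[𝕜] V := LinearMap.id - ((a k z)⁻¹ • a k).smulRight z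
    have proj_apply (x : V) : proj x = x - (a k x / a k z) • z := by
      simp [proj, div_eq_inv_mul]
    obtain ⟨w, hw, hc⟩ := ih (fun j => a j ∘ₗ proj) (c ∘ₗ proj) fun x hx =>
      h (proj x) (forall_mem_insert .. |>.2 ⟨by simp [proj_apply, hkz.ne], hx⟩)
    have hsum : 0 ≤ ∑ j ∈ s, w j * a j z := sum_nonneg fun j hj => mul_nonneg (hw j) (hz j hj)
    refine ⟨w, hw, _, ?_, eq_add_smul_of_comp_projection_eq hkz.ne fun x => ?_⟩
    · refine div_nonneg_of_nonpos ?_ hkz.le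
      simp only [LinearMap.sum_apply, LinearMap.smul_apply, smul_eq_mul]
      linarith
    · simpa [proj_apply] using LinearMap.congr_fun hc x

theorem exists_infeasibility_certificate (s : Finset J) (a : J → V →ₗ[𝕜] 𝕜) (b : J → 𝕜)
    (h : ¬ ∃ y, ∀ j ∈ s, b j ≤ a j y) :
    ∃ w : J → 𝕜, (∀ j, 0 ≤ w j) ∧ ∑ j ∈ s, w j • a j = 0 ∧ ∑ j ∈ s, w j * b j = 1 := by
  obtain ⟨w, hw, hc⟩ := farkas s
    (fun j => a j ∘ₗ LinearMap.fst 𝕜 V 𝕜 - b j • LinearMap.snd 𝕜 V 𝕜) (-LinearMap.snd 𝕜 V 𝕜) <| by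
      rintro ⟨y, t⟩ hy
      by_contra! ht
      replace ht : 0 < t := by simpa using ht
      refine h ⟨t⁻¹ • y, fun j hj => ?_⟩
      rw [map_smul, smul_eq_mul, ← div_eq_inv_mul, le_div_iff₀ ht]
      simpa using hy j hj
  refine ⟨w, hw, LinearMap.ext fun y => ?_, ?_⟩
  · simpa using (LinearMap.congr_fun hc (y, 0)).symm
  · simpa using (LinearMap.congr_fun hc (0, 1)).symm

theorem nonneg_of_forall_le_apply_add_smul {f : V →ₗ[𝕜] 𝕜} {d : 𝕜} {y₀ y : V}
    (h : ∀ t : 𝕜, 0 ≤ t → d ≤ f (y₀ + t • y)) : 0 ≤ f y := by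
  by_contra! hy
  have h₀ : d ≤ f y₀ := by simpa using h 0 le_rfl
  have key := h ((f y₀ - d + 1) / -f y) (div_nonneg (by linarith) (by linarith))
  have hcancel : (f y₀ - d + 1) / -f y * f y = -(f y₀ - d + 1) := by
    field_simp [hy.ne]
  rw [map_add, map_smul, smul_eq_mul, hcancel] at key
  linarith

theorem affine_farkas (s : Finset J) (a : J → V →ₗ[𝕜] 𝕜) (b : J → 𝕜) (f : V →ₗ[𝕜] 𝕜) (d : 𝕜)
    (hs : ∃ y, ∀ j ∈ s, b j ≤ a j y) (h : ∀ y, (∀ j ∈ s, b j ≤ a j y) → d ≤ f y) :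
    ∃ w : J → 𝕜, (∀ j, 0 ≤ w j) ∧ f = ∑ j ∈ s, w j • a j ∧ d ≤ ∑ j ∈ s, w j * b j := by
  obtain ⟨y₀, hy₀⟩ := hs
  let τ : V × 𝕜 →ₗ[𝕜] 𝕜 := LinearMap.snd 𝕜 V 𝕜
  obtain ⟨w, hw, hf⟩ := farkas (insertNone s)
    (fun o => o.elim τ fun j => a j ∘ₗ LinearMap.fst 𝕜 V 𝕜 - b j • τ)
    (f ∘ₗ LinearMap.fst 𝕜 V 𝕜 - d • τ) <| by
      rintro ⟨y, t⟩ hy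
      obtain ⟨ht, hy⟩ : 0 ≤ t ∧ ∀ j ∈ s, b j * t ≤ a j y := by
        simpa [τ, Option.forall] using hy
      suffices d * t ≤ f y by simpa [τ] using this
      rcases ht.eq_or_lt with rfl | ht
      · rw [mul_zero]
        refine nonneg_of_forall_le_apply_add_smul (d := d) (y₀ := y₀) fun t ht => h _ fun j hj => ?_
        have hyj : 0 ≤ a j y := by simpa using hy j hj
        rw [map_add, map_smul, smul_eq_mul]
        exact le_add_of_le_of_nonneg (hy₀ j hj) (mul_nonneg ht hyj)
      · have := h (t⁻¹ • y) fun j hj => by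
          rw [map_smul, smul_eq_mul, ← div_eq_inv_mul, le_div_iff₀ ht]
          exact hy j hj
        rwa [map_smul, smul_eq_mul, ← div_eq_inv_mul, le_div_iff₀ ht] at this
  refine ⟨fun j => w (some j), fun j => hw _, LinearMap.ext fun y => ?_, ?_⟩
  · simpa [τ] using LinearMap.congr_fun hf (y, 0)
  · have h₁ : -d = w none - ∑ j ∈ s, w (some j) * b j := by
      simpa [τ, sub_eq_add_neg] using LinearMap.congr_fun hf (0, 1)
    linarith [hw none]

theorem exists_forall_le_of_bddBelow_polyhedron {V : Type*} [AddCommGroup V] [Module ℝ V]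
    (s : Finset J) (a : J → V →ₗ[ℝ] ℝ) (b : J → ℝ) (f : V →ₗ[ℝ] ℝ) (hs : ∃ y, ∀ j ∈ s, b j ≤ a j y)
    (hf : BddBelow (f '' {y | ∀ j ∈ s, b j ≤ a j y})) :
    ∃ y, (∀ j ∈ s, b j ≤ a j y) ∧ ∀ y', (∀ j ∈ s, b j ≤ a j y') → f y ≤ f y' := by
  set K : Set V := {y | ∀ j ∈ s, b j ≤ a j y} with hK
  have hne : (f '' K).Nonempty := Set.Nonempty.image f hs
  suffices ∃ y, ∀ o ∈ insertNone s,
      o.elim (-sInf (f '' K)) b ≤ (o.elim (-f) a : V →ₗ[ℝ] ℝ) y by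
    obtain ⟨y, hy⟩ := this
    obtain ⟨hfy, hy⟩ : f y ≤ sInf (f '' K) ∧ y ∈ K := by
      simpa [hK, Option.forall] using hy
    exact ⟨y, hy, fun y' hy' => hfy.trans (csInf_le hf ⟨y', hy', rfl⟩)⟩
  by_contra hinf
  obtain ⟨w, hw, ha, hb⟩ := exists_infeasibility_certificate _ _ _ hinf
  rw [sum_insertNone] at ha hb
  simp only [Option.elim_none, Option.elim_some] at ha hb
  -- the certificate raises the lower bound on `w none * f` by `1`
  have hgap : ∀ y ∈ K, w none * sInf (f '' K) + 1 ≤ w none * f y := fun y hy => by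
    have hay : ∑ j ∈ s, w (some j) * a j y = w none * f y := by
      have := LinearMap.congr_fun ha y
      simp only [LinearMap.add_apply, LinearMap.smul_apply, LinearMap.neg_apply,
        LinearMap.sum_apply, smul_eq_mul, LinearMap.zero_apply] at this
      linarith
    have := sum_le_sum fun j hj => mul_le_mul_of_nonneg_left (hy j hj) (hw (some j))
    linarith
  rcases (hw none).eq_or_lt with h₀ | h₀
  · obtain ⟨y, hy⟩ := hs
    have := hgap y hy
    rw [← h₀] at this
    linarith
  · obtain ⟨_, ⟨y, hy, rfl⟩, hlt⟩ := exists_lt_of_csInf_lt hne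
      (lt_add_of_pos_right (sInf (f '' K)) (inv_pos.2 h₀))
    have := mul_lt_mul_of_pos_left hlt h₀
    rw [mul_add, mul_inv_cancel₀ h₀.ne'] at this
    linarith [hgap y hy]

end LinearProgramming

namespace ProbeBandit

variable {n : ℕ}

section StateProbabilities

variable (I : ProbeBandit n)

/-- Probability that arm `i` is in state `g` when it was observed in state `s` exactly `t` steps
ago: the numbers `u` and `v` of the linear programs under one name. -/
def goodProb (i : Fin n) (s : Bool) (t : ℕ) : ℝ := if s then I.u i t else I.v i t

/-- Expected change of the indicator of the state `g` in the `t` steps after an observation of the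
state `s`. This is the coefficient of `p i` in the probe constraints of the dual. -/
def gain (i : Fin n) (s : Bool) (t : ℕ) : ℝ := I.goodProb i s t - if s then 1 else 0

@[simp]
theorem goodProb_true (i : Fin n) (t : ℕ) : I.goodProb i true t = I.u i t := rfl

@[simp]
theorem goodProb_false (i : Fin n) (t : ℕ) : I.goodProb i false t = I.v i t := rfl

theorem rate_pos (i : Fin n) : 0 < I.α i + I.β i := add_pos (I.α_pos i) (I.β_pos i)

theorem v_mono (i : Fin n) : Monotone (I.v i) := fun t t' h => by
  have hpow := pow_le_pow_of_le_one (by linarith [I.bursty i] : 0 ≤ 1 - I.α i - I.β i)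
    (by linarith [I.rate_pos i]) h
  exact mul_le_mul_of_nonneg_left (by linarith) (div_nonneg (I.α_pos i).le (I.rate_pos i).le)

theorem u_anti (i : Fin n) : Antitone (I.u i) := fun t t' h => by
  have hpow := pow_le_pow_of_le_one (by linarith [I.bursty i] : 0 ≤ 1 - I.α i - I.β i)
    (by linarith [I.rate_pos i]) h
  exact add_le_add_right
    (mul_le_mul_of_nonneg_left hpow (div_nonneg (I.β_pos i).le (I.rate_pos i).le)) _

theorem goodProb_zero (i : Fin n) (s : Bool) : I.goodProb i s 0 = if s then 1 else 0 := by
  have := (I.rate_pos i).ne'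
  cases s <;> simp [goodProb, u, v]
  field_simp

theorem goodProb_succ (i : Fin n) (s : Bool) (t : ℕ) :
    I.goodProb i s (t + 1) =
      I.goodProb i s t * (1 - I.β i) + (1 - I.goodProb i s t) * I.α i := by
  have := (I.rate_pos i).ne'
  cases s <;> simp only [goodProb, u, v, pow_succ, Bool.false_eq_true, if_true, if_false] <;>
    field_simp <;> ring

theorem v_one (i : Fin n) : I.v i 1 = I.α i := by
  rw [← goodProb_false, ← zero_add 1, goodProb_succ, goodProb_zero]
  simp

theorem u_one (i : Fin n) : I.u i 1 = 1 - I.β i := by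
  rw [← goodProb_true, ← zero_add 1, goodProb_succ, goodProb_zero]
  simp

theorem v_pos (i : Fin n) {t : ℕ} (ht : 1 ≤ t) : 0 < I.v i t :=
  (I.α_pos i).trans_le (I.v_one i ▸ I.v_mono i ht)

theorem u_lt_one (i : Fin n) {t : ℕ} (ht : 1 ≤ t) : I.u i t < 1 := by
  linarith [I.u_anti i ht, I.u_one i, I.β_pos i]

theorem v_le_u (i : Fin n) (t t' : ℕ) : I.v i t ≤ I.u i t' := by
  have hρ : 0 < 1 - I.α i - I.β i := by linarith [I.bursty i]
  have hv := mul_pos (div_pos (I.α_pos i) (I.rate_pos i)) (pow_pos hρ t)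
  have hu := mul_pos (div_pos (I.β_pos i) (I.rate_pos i)) (pow_pos hρ t')
  simp only [u, v]
  linarith

theorem goodProb_nonneg (i : Fin n) (s : Bool) (t : ℕ) : 0 ≤ I.goodProb i s t := by
  have hv : 0 ≤ I.v i 0 := (I.goodProb_zero i false).ge
  cases s
  exacts [hv.trans (I.v_mono i t.zero_le), hv.trans (I.v_le_u i 0 t)]

theorem goodProb_le_one (i : Fin n) (s : Bool) (t : ℕ) : I.goodProb i s t ≤ 1 := by
  have hu : I.u i 0 ≤ 1 := (I.goodProb_zero i true).le
  cases s
  exacts [(I.v_le_u i t 0).trans hu, (I.u_anti i t.zero_le).trans hu]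

theorem R_nonneg (i : Fin n) (s : Bool) (t : ℕ) : 0 ≤ I.R i s t :=
  mul_nonneg (I.r_nonneg i) (I.goodProb_nonneg i s t)

theorem R_le (i : Fin n) (s : Bool) (t : ℕ) : I.R i s t ≤ I.r i :=
  mul_le_of_le_one_right (I.r_nonneg i) (I.goodProb_le_one i s t)

theorem R_true_anti (i : Fin n) : Antitone (I.R i true) := fun _ _ h =>
  mul_le_mul_of_nonneg_left (I.u_anti i h) (I.r_nonneg i)

theorem R_false_mono (i : Fin n) : Monotone (I.R i false) := fun _ _ h =>
  mul_le_mul_of_nonneg_left (I.v_mono i h) (I.r_nonneg i)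

theorem R_false_le_R_true (i : Fin n) (t t' : ℕ) : I.R i false t ≤ I.R i true t' :=
  mul_le_mul_of_nonneg_left (I.v_le_u i t t') (I.r_nonneg i)

end StateProbabilities

section WeakDuality

variable (I : ProbeBandit n) {M T : ℕ} {P : PrimalPoint n} {D : DualPoint n}

/-- Slack of the constraint of the dual for plays of arm `i` that was observed in state `s` exactly
`t` steps ago; its multiplier is `x i s t`. -/
def playSlack (D : DualPoint n) (i : Fin n) (s : Bool) (t : ℕ) : ℝ :=
  D.lam + D.φ i s t - I.R i s t

/-- Slack of the constraint of the dual for probes of arm `i` that was observed in state `s`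
exactly `t` steps ago (the constraint `good` or `bad`); its multiplier is `z i s t`. -/
def probeSlack (D : DualPoint n) (i : Fin n) (s : Bool) (t : ℕ) : ℝ :=
  t * D.h i - (-I.c i + I.gain i s t * D.p i + ∑ l ∈ Icc 1 t, D.φ i s l)

/-- Slack of the primal constraint on the number of plays per time step; its multiplier is `λ`. -/
def PrimalPoint.capacitySlack (M T : ℕ) (P : PrimalPoint n) : ℝ :=
  M * (1 - P.ω) - ∑ i, ∑ s, ∑ t ∈ Icc 1 T, P.x i s t

/-- Slack of the primal constraint on the time that arm `i` takes; its multiplier is `h i`. -/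
def PrimalPoint.timeSlack (T : ℕ) (P : PrimalPoint n) (i : Fin n) : ℝ :=
  1 + P.ω - ∑ s, ∑ t ∈ Icc 1 T, t * P.z i s t

/-- Slack of the primal constraint that arm `i` is played at most once at each distance `t` from
an observation of `s`; its multiplier is `φ i s t`. -/
def PrimalPoint.playCountSlack (T : ℕ) (P : PrimalPoint n) (i : Fin n) (s : Bool) (t : ℕ) : ℝ :=
  ∑ l ∈ Icc t T, P.z i s l - P.x i s t

theorem sum_mul_sum_Icc (T : ℕ) (f g : ℕ → ℝ) :
    ∑ t ∈ Icc 1 T, f t * ∑ l ∈ Icc 1 t, g l = ∑ l ∈ Icc 1 T, g l * ∑ t ∈ Icc l T, f t := by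
  simp only [mul_sum]
  rw [sum_comm' (s' := fun l => Icc l T) (t' := Icc 1 T)
    (h := by intro x y; simp only [mem_Icc]; omega)]
  simp only [mul_comm]

theorem primalObjective_eq (T : ℕ) (P : PrimalPoint n) : I.primalObjective T P =
    ∑ i, ∑ s, ∑ t ∈ Icc 1 T, (P.x i s t * I.R i s t - I.c i * P.z i s t) := by
  refine sum_congr rfl fun i _ => ?_
  rw [Fintype.sum_bool, ← sum_add_distrib]
  refine sum_congr rfl fun t _ => ?_
  simp only [R, if_true, Bool.false_eq_true, if_false]
  ring

variable {I}

theorem PrimalFeasible.flow_gain (hP : I.PrimalFeasible M T P) (i : Fin n) :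
    ∑ s, ∑ t ∈ Icc 1 T, P.z i s t * I.gain i s t = 0 := by
  simp only [Fintype.sum_bool, gain, goodProb, if_true, Bool.false_eq_true, if_false, sub_zero]
  simp only [mul_comm (P.z i _ _), ← neg_sub 1 (I.u _ _), neg_mul, sum_neg_distrib, hP.flow i,
    neg_add_cancel]

theorem sum_mul_probeSlack {i : Fin n} (D : DualPoint n)
    (hflow : ∑ s, ∑ t ∈ Icc 1 T, P.z i s t * I.gain i s t = 0) :
    ∑ s, ∑ t ∈ Icc 1 T, P.z i s t * I.probeSlack D i s t =
      D.h i * ∑ s, ∑ t ∈ Icc 1 T, t * P.z i s t + ∑ s, ∑ t ∈ Icc 1 T, I.c i * P.z i s t -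
        ∑ s, ∑ t ∈ Icc 1 T, D.φ i s t * ∑ l ∈ Icc t T, P.z i s l := by
  have hterm : ∀ s t, P.z i s t * I.probeSlack D i s t = D.h i * (t * P.z i s t) +
      I.c i * P.z i s t - D.p i * (P.z i s t * I.gain i s t) -
        P.z i s t * ∑ l ∈ Icc 1 t, D.φ i s l := fun s t => by
    rw [probeSlack]
    ring
  simp only [hterm, sum_sub_distrib, sum_add_distrib, ← mul_sum, hflow, mul_zero, sub_zero,
    sum_mul_sum_Icc]

/-- The Lagrangian identity: the duality gap is the sum of the products of all multipliers with the
slacks of their constraints. -/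
theorem dualObjective_sub_primalObjective
    (hflow : ∀ i, ∑ s, ∑ t ∈ Icc 1 T, P.z i s t * I.gain i s t = 0)
    (hbal : M * D.lam = ∑ i, D.h i) :
    dualObjective M D - I.primalObjective T P =
      D.lam * P.capacitySlack M T + ∑ i, D.h i * P.timeSlack T i +
      (∑ i, ∑ s, ∑ t ∈ Icc 1 T, P.x i s t * I.playSlack D i s t) +
      (∑ i, ∑ s, ∑ t ∈ Icc 1 T, D.φ i s t * P.playCountSlack T i s t) +
      ∑ i, ∑ s, ∑ t ∈ Icc 1 T, P.z i s t * I.probeSlack D i s t := by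
  simp only [fun i => sum_mul_probeSlack D (hflow i)]
  simp only [primalObjective_eq, dualObjective, PrimalPoint.capacitySlack, PrimalPoint.timeSlack,
    PrimalPoint.playCountSlack, playSlack, mul_sub, mul_add, sum_sub_distrib, sum_add_distrib,
    mul_one, ← sum_mul, mul_comm (D.φ _ _ _) (P.x _ _ _)]
  simp only [← mul_sum, ← hbal]
  ring

theorem PrimalFeasible.capacitySlack_nonneg (hP : I.PrimalFeasible M T P) :
    0 ≤ P.capacitySlack M T := by
  simpa only [PrimalPoint.capacitySlack, Fintype.sum_bool, sub_nonneg, sum_add_distrib]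
    using hP.plays

theorem PrimalFeasible.timeSlack_nonneg (hP : I.PrimalFeasible M T P) (i : Fin n) :
    0 ≤ P.timeSlack T i := by
  simpa only [PrimalPoint.timeSlack, Fintype.sum_bool, sub_nonneg, mul_add, sum_add_distrib]
    using hP.time i

theorem PrimalFeasible.playCountSlack_nonneg (hP : I.PrimalFeasible M T P) (i : Fin n) (s : Bool)
    {t : ℕ} (ht : t ∈ Icc 1 T) : 0 ≤ P.playCountSlack T i s t :=
  sub_nonneg.2 (hP.play_le i s t ht)

theorem DualFeasible.playSlack_nonneg (hD : I.DualFeasible M T D) (i : Fin n) (s : Bool)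
    {t : ℕ} (ht : t ∈ Icc 1 T) : 0 ≤ I.playSlack D i s t :=
  sub_nonneg.2 (hD.play i s t ht)

theorem probeSlack_zero (I : ProbeBandit n) (D : DualPoint n) (i : Fin n) (s : Bool) :
    I.probeSlack D i s 0 = I.c i := by
  simp [probeSlack, gain, goodProb_zero]

theorem DualFeasible.probeSlack_nonneg (hD : I.DualFeasible M T D) (i : Fin n) (s : Bool)
    {t : ℕ} (ht : t ≤ T) : 0 ≤ I.probeSlack D i s t := by
  rcases t.eq_zero_or_pos with rfl | hpos
  · rw [probeSlack_zero]
    exact I.c_nonneg i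
  have ht : t ∈ Icc 1 T := mem_Icc.2 ⟨hpos, ht⟩
  cases s <;> simp only [probeSlack, gain, goodProb, if_true, Bool.false_eq_true, if_false]
  · linarith [hD.bad i t ht]
  · linarith [hD.good i t ht]

theorem weak_duality (hP : I.PrimalFeasible M T P) (hD : I.DualFeasible M T D) :
    I.primalObjective T P ≤ dualObjective M D := by
  have hgap := dualObjective_sub_primalObjective hP.flow_gain hD.balance
  rw [← sub_nonneg, hgap]
  refine add_nonneg (add_nonneg (add_nonneg (add_nonneg ?_ ?_) ?_) ?_) ?_
  · exact mul_nonneg hD.lam_nonneg hP.capacitySlack_nonneg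
  · exact sum_nonneg fun i _ => mul_nonneg (hD.h_nonneg i) (hP.timeSlack_nonneg i)
  all_goals refine sum_nonneg fun i _ => sum_nonneg fun s _ => sum_nonneg fun t ht => ?_
  · exact mul_nonneg (hP.x_nonneg i s t ht) (hD.playSlack_nonneg i s ht)
  · exact mul_nonneg (hD.φ_nonneg i s t ht) (hP.playCountSlack_nonneg i s ht)
  · exact mul_nonneg (hP.z_nonneg i s t ht) (hD.probeSlack_nonneg i s (mem_Icc.1 ht).2)

/-- Complementary slackness: constraints with a nonzero multiplier are tight. -/
structure ComplementarySlack (I : ProbeBandit n) (T : ℕ) (P : PrimalPoint n) (D : DualPoint n) :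
    Prop where
  time : ∀ i, D.h i ≠ 0 → P.timeSlack T i = 0
  play : ∀ i s, ∀ t ∈ Icc 1 T, P.x i s t ≠ 0 → I.playSlack D i s t = 0
  playCount : ∀ i s, ∀ t ∈ Icc 1 T, D.φ i s t ≠ 0 → P.playCountSlack T i s t = 0
  probe : ∀ i s, ∀ t ∈ Icc 1 T, P.z i s t ≠ 0 → I.probeSlack D i s t = 0

theorem sum_sum_sum_nonneg {ι κ τ : Type*} {s : Finset ι} {t : Finset κ} {r : Finset τ}
    {f : ι → κ → τ → ℝ} (hf : ∀ i ∈ s, ∀ j ∈ t, ∀ k ∈ r, 0 ≤ f i j k) :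
    0 ≤ ∑ i ∈ s, ∑ j ∈ t, ∑ k ∈ r, f i j k :=
  sum_nonneg fun i hi => sum_nonneg fun j hj => sum_nonneg (hf i hi j hj)

theorem eq_zero_of_sum_sum_sum_nonpos {ι κ τ : Type*} {s : Finset ι} {t : Finset κ} {r : Finset τ}
    {f : ι → κ → τ → ℝ} (hf : ∀ i ∈ s, ∀ j ∈ t, ∀ k ∈ r, 0 ≤ f i j k)
    (h : ∑ i ∈ s, ∑ j ∈ t, ∑ k ∈ r, f i j k ≤ 0) {i : ι} (hi : i ∈ s) {j : κ} (hj : j ∈ t)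
    {k : τ} (hk : k ∈ r) : f i j k = 0 := by
  rw [← sum_product', ← sum_product'] at h
  have hf' : ∀ x ∈ (s ×ˢ t) ×ˢ r, 0 ≤ f x.1.1 x.1.2 x.2 := fun x hx => by
    obtain ⟨⟨hi, hj⟩, hk⟩ := by simpa only [mem_product] using hx
    exact hf _ hi _ hj _ hk
  exact (sum_eq_zero_iff_of_nonneg hf').1 (h.antisymm (sum_nonneg hf')) ((i, j), k) (by simp [*])

theorem complementarySlack_of_objective_eq (hP : I.PrimalFeasible M T P)
    (hD : I.DualFeasible M T D) (heq : I.primalObjective T P = dualObjective M D) :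
    ComplementarySlack I T P D := by
  have hgap := dualObjective_sub_primalObjective hP.flow_gain hD.balance
  rw [heq, sub_self] at hgap
  have hcapacity := mul_nonneg hD.lam_nonneg hP.capacitySlack_nonneg
  have htime : ∀ i ∈ univ, 0 ≤ D.h i * P.timeSlack T i := fun i _ =>
    mul_nonneg (hD.h_nonneg i) (hP.timeSlack_nonneg i)
  have hplay : ∀ i ∈ univ, ∀ s ∈ univ, ∀ t ∈ Icc 1 T, 0 ≤ P.x i s t * I.playSlack D i s t :=
    fun i _ s _ t ht => mul_nonneg (hP.x_nonneg i s t ht) (hD.playSlack_nonneg i s ht)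
  have hcount : ∀ i ∈ univ, ∀ s ∈ univ, ∀ t ∈ Icc 1 T, 0 ≤ D.φ i s t * P.playCountSlack T i s t :=
    fun i _ s _ t ht => mul_nonneg (hD.φ_nonneg i s t ht) (hP.playCountSlack_nonneg i s ht)
  have hprobe : ∀ i ∈ univ, ∀ s ∈ univ, ∀ t ∈ Icc 1 T, 0 ≤ P.z i s t * I.probeSlack D i s t :=
    fun i _ s _ t ht =>
      mul_nonneg (hP.z_nonneg i s t ht) (hD.probeSlack_nonneg i s (mem_Icc.1 ht).2)
  have htime₀ := sum_nonneg htime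
  have hplay₀ := sum_sum_sum_nonneg hplay
  have hcount₀ := sum_sum_sum_nonneg hcount
  have hprobe₀ := sum_sum_sum_nonneg hprobe
  refine ⟨fun i hi => ?_, fun i s t ht hx => ?_, fun i s t ht hφ => ?_, fun i s t ht hz => ?_⟩
  · exact (mul_eq_zero.1 ((sum_eq_zero_iff_of_nonneg htime).1 (by linarith) i
      (mem_univ i))).resolve_left hi
  · exact (mul_eq_zero.1 (eq_zero_of_sum_sum_sum_nonpos hplay (by linarith) (mem_univ i)
      (mem_univ s) ht)).resolve_left hx
  · exact (mul_eq_zero.1 (eq_zero_of_sum_sum_sum_nonpos hcount (by linarith) (mem_univ i)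
      (mem_univ s) ht)).resolve_left hφ
  · exact (mul_eq_zero.1 (eq_zero_of_sum_sum_sum_nonpos hprobe (by linarith) (mem_univ i)
      (mem_univ s) ht)).resolve_left hz

end WeakDuality

section StrongDuality

variable {I : ProbeBandit n} {M T : ℕ} {D : DualPoint n}

/-- The balanced dual without the sign constraint on `p`, whose multipliers satisfy the flow
constraint of the primal with equality. -/
structure RelaxedDualFeasible (I : ProbeBandit n) (M T : ℕ) (D : DualPoint n) : Prop where
  lam_nonneg : 0 ≤ D.lam
  h_nonneg : ∀ i, 0 ≤ D.h i
  φ_nonneg : ∀ i s, ∀ t ∈ Icc 1 T, 0 ≤ D.φ i s t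
  play : ∀ i s, ∀ t ∈ Icc 1 T, 0 ≤ I.playSlack D i s t
  probe : ∀ i s, ∀ t ∈ Icc 1 T, 0 ≤ I.probeSlack D i s t
  balance : M * D.lam = ∑ i, D.h i

theorem DualFeasible.relaxed (hD : I.DualFeasible M T D) : I.RelaxedDualFeasible M T D :=
  ⟨hD.lam_nonneg, hD.h_nonneg, hD.φ_nonneg, fun i s _ ht => hD.playSlack_nonneg i s ht,
    fun i s _ ht => hD.probeSlack_nonneg i s (mem_Icc.1 ht).2, hD.balance⟩

variable (I) in
/-- The point with the prices `p` truncated at `0` and the smallest multipliers `φ` that the play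
constraints allow. -/
def truncate (D : DualPoint n) : DualPoint n where
  lam := D.lam
  h := D.h
  p i := max 0 (D.p i)
  φ i s t := max 0 (I.R i s t - D.lam)

theorem RelaxedDualFeasible.sum_truncate_φ_le (hD : I.RelaxedDualFeasible M T D) (i : Fin n)
    (s : Bool) {t : ℕ} (ht : t ∈ Icc 1 T) :
    ∑ l ∈ Icc 1 t, (I.truncate D).φ i s l ≤ ∑ l ∈ Icc 1 t, D.φ i s l :=
  sum_le_sum fun l hl => by
    have hl' : l ∈ Icc 1 T := Icc_subset_Icc_right (mem_Icc.1 ht).2 hl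
    refine max_le (hD.φ_nonneg i s l hl') ?_
    have := hD.play i s l hl'
    rw [playSlack] at this
    linarith

theorem RelaxedDualFeasible.truncate_good (hD : I.RelaxedDualFeasible M T D) (i : Fin n) {t : ℕ}
    (ht : t ∈ Icc 1 T) :
    -I.c i - (1 - I.u i t) * max 0 (D.p i) + ∑ l ∈ Icc 1 t, (I.truncate D).φ i true l ≤
      t * D.h i := by
  have hprobe := hD.probe i true t ht
  simp only [probeSlack, gain, goodProb_true, if_true] at hprobe
  have hp := mul_le_mul_of_nonneg_left (le_max_right 0 (D.p i))
    (sub_nonneg.2 (I.goodProb_le_one i true t))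
  rw [goodProb_true] at hp
  linarith [hD.sum_truncate_φ_le i true ht]

/-- If `p i < 0`, then the `bad` constraint with `p i = 0` follows from the `good` constraint, since
the multipliers `φ i false` of the truncation are at most `φ i true`. -/
theorem RelaxedDualFeasible.truncate_bad (hD : I.RelaxedDualFeasible M T D) (i : Fin n) {t : ℕ}
    (ht : t ∈ Icc 1 T) :
    -I.c i + I.v i t * max 0 (D.p i) + ∑ l ∈ Icc 1 t, (I.truncate D).φ i false l ≤ t * D.h i := by
  rcases le_total 0 (D.p i) with hp | hp
  · have hprobe := hD.probe i false t ht
    simp only [probeSlack, gain, goodProb_false, Bool.false_eq_true, if_false] at hprobe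
    rw [max_eq_right hp]
    linarith [hD.sum_truncate_φ_le i false ht]
  · have hgood := hD.truncate_good i ht
    rw [max_eq_left hp] at hgood ⊢
    have hφ : ∑ l ∈ Icc 1 t, (I.truncate D).φ i false l ≤
        ∑ l ∈ Icc 1 t, (I.truncate D).φ i true l :=
      sum_le_sum fun l _ => max_le_max le_rfl (sub_le_sub_right (I.R_false_le_R_true i l l) _)
    linarith

theorem RelaxedDualFeasible.dualFeasible_truncate (hD : I.RelaxedDualFeasible M T D) :
    I.DualFeasible M T (I.truncate D) where
  lam_nonneg := hD.lam_nonneg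
  h_nonneg := hD.h_nonneg
  p_nonneg _ := le_max_left _ _
  φ_nonneg _ _ _ _ := le_max_left _ _
  play i s t _ := sub_le_iff_le_add'.1 (le_max_right 0 (I.R i s t - D.lam))
  good i _ ht := hD.truncate_good i ht
  bad i _ ht := hD.truncate_bad i ht
  balance := hD.balance

variable (I M T) in
theorem exists_dualFeasible : ∃ D, I.DualFeasible M T D := by
  have hr₀ : 0 ≤ ∑ j, I.r j := sum_nonneg fun j _ => I.r_nonneg j
  have hr : ∀ i, I.r i ≤ ∑ j, I.r j := fun i =>
    single_le_sum (fun j _ => I.r_nonneg j) (mem_univ i)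
  have hprobe : ∀ i (t : ℕ), -I.c i ≤ t * (M * (∑ j, I.r j) / n) := fun i t =>
    (neg_nonpos.2 (I.c_nonneg i)).trans (by positivity)
  refine ⟨⟨∑ j, I.r j, fun _ => M * (∑ j, I.r j) / n, 0, 0⟩, hr₀, fun _ => by positivity,
    fun _ => le_rfl, fun _ _ _ _ => le_rfl, fun i s t _ => ?_, fun i t _ => ?_, fun i t _ => ?_, ?_⟩
  · simpa using (I.R_le i s t).trans (hr i)
  · simpa using hprobe i t
  · simpa using hprobe i t
  · rcases eq_or_ne n 0 with rfl | hn
    · simp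
    · simp only [sum_const, card_univ, Fintype.card_fin, nsmul_eq_mul]
      field_simp

/-- The coordinates of a dual point, through which `DualPoint n` becomes a vector space. -/
def dualPointEquiv :
    DualPoint n ≃ ℝ × (Fin n → ℝ) × (Fin n → ℝ) × (Fin n → Bool → ℕ → ℝ) where
  toFun D := (D.lam, D.h, D.p, D.φ)
  invFun y := ⟨y.1, y.2.1, y.2.2.1, y.2.2.2⟩
  left_inv _ := rfl
  right_inv _ := rfl

instance : AddCommGroup (DualPoint n) := dualPointEquiv.addCommGroup

instance : Module ℝ (DualPoint n) := dualPointEquiv.module ℝ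

namespace DualPoint

/-- The variable `λ` as a linear functional. -/
@[simps]
def lamForm : DualPoint n →ₗ[ℝ] ℝ where
  toFun D := D.lam
  map_add' _ _ := rfl
  map_smul' _ _ := rfl

/-- The variable `h i` as a linear functional. -/
@[simps]
def hForm (i : Fin n) : DualPoint n →ₗ[ℝ] ℝ where
  toFun D := D.h i
  map_add' _ _ := rfl
  map_smul' _ _ := rfl

/-- The variable `p i` as a linear functional. -/
@[simps]
def pForm (i : Fin n) : DualPoint n →ₗ[ℝ] ℝ where
  toFun D := D.p i
  map_add' _ _ := rfl
  map_smul' _ _ := rfl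

/-- The variable `φ i s t` as a linear functional. -/
@[simps]
def φForm (i : Fin n) (s : Bool) (t : ℕ) : DualPoint n →ₗ[ℝ] ℝ where
  toFun D := D.φ i s t
  map_add' _ _ := rfl
  map_smul' _ _ := rfl

/-- The dual objective as a linear functional. -/
def objectiveForm (M : ℕ) : DualPoint n →ₗ[ℝ] ℝ := (M : ℝ) • lamForm + ∑ i, hForm i

theorem objectiveForm_apply (M : ℕ) (D : DualPoint n) :
    objectiveForm M D = dualObjective M D := by
  simp [objectiveForm, dualObjective]

end DualPoint

open DualPoint

/-- Names of the constraints of the relaxed dual: the signs of `λ`, `h` and `φ`, the play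
constraints, the probe constraints, and the two inequalities that make up the balance constraint
(`true` for `0 ≤ M λ - ∑ i, h i`). -/
abbrev DualIndex (n : ℕ) :=
  Unit ⊕ Fin n ⊕ (Fin n × Bool × ℕ) ⊕ (Fin n × Bool × ℕ) ⊕ (Fin n × Bool × ℕ) ⊕ Bool

/-- The constraints of the relaxed dual with horizon `T`. -/
def dualIndices (n T : ℕ) : Finset (DualIndex n) :=
  let times : Finset (Fin n × Bool × ℕ) := univ ×ˢ univ ×ˢ Icc 1 T
  univ.disjSum (univ.disjSum (times.disjSum (times.disjSum (times.disjSum univ))))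

/-- The constraint `k` of the relaxed dual is `I.dualBound k ≤ I.dualForm M k D`. -/
def dualForm (I : ProbeBandit n) (M : ℕ) : DualIndex n → DualPoint n →ₗ[ℝ] ℝ
  | .inl _ => lamForm
  | .inr (.inl i) => hForm i
  | .inr (.inr (.inl (i, s, t))) => φForm i s t
  | .inr (.inr (.inr (.inl (i, s, t)))) => lamForm + φForm i s t
  | .inr (.inr (.inr (.inr (.inl (i, s, t))))) =>
    (t : ℝ) • hForm i - I.gain i s t • pForm i - ∑ l ∈ Icc 1 t, φForm i s l
  | .inr (.inr (.inr (.inr (.inr true)))) => (M : ℝ) • lamForm - ∑ i, hForm i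
  | .inr (.inr (.inr (.inr (.inr false)))) => ∑ i, hForm i - (M : ℝ) • lamForm

/-- The constraint `k` of the relaxed dual is `I.dualBound k ≤ I.dualForm M k D`. -/
def dualBound (I : ProbeBandit n) : DualIndex n → ℝ
  | .inr (.inr (.inr (.inl (i, s, t)))) => I.R i s t
  | .inr (.inr (.inr (.inr (.inl (i, _, _))))) => -I.c i
  | _ => 0

theorem forall_dualBound_le_dualForm_iff :
    (∀ k ∈ dualIndices n T, I.dualBound k ≤ I.dualForm M k D) ↔ I.RelaxedDualFeasible M T D := by
  have hprobe : ∀ i s (t : ℕ), -I.c i ≤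
      t * D.h i - I.gain i s t * D.p i - ∑ l ∈ Icc 1 t, D.φ i s l ↔
        0 ≤ I.probeSlack D i s t := fun i s t => by
    rw [probeSlack]
    constructor <;> intro h <;> linarith
  simp only [dualIndices, Sum.forall, inl_mem_disjSum, inr_mem_disjSum, mem_univ, mem_product,
    true_and, Prod.forall, forall_const, Bool.forall_bool, dualForm, dualBound, lamForm_apply,
    hForm_apply, pForm_apply, φForm_apply, LinearMap.add_apply, LinearMap.sub_apply,
    LinearMap.smul_apply, LinearMap.sum_apply, smul_eq_mul, hprobe, sub_nonneg]
  constructor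
  · rintro ⟨hlam, hh, hφ, hplay, hpr, hge, hle⟩
    refine ⟨hlam, hh, ?_, ?_, ?_, hge.antisymm hle⟩ <;> rintro i (_ | _) t ht
    all_goals simp_all [playSlack]
  · rintro ⟨hlam, hh, hφ, hplay, hpr, hbal⟩
    simp_all [playSlack]

variable (I M T) in
theorem exists_dualOptimal : ∃ D, I.DualOptimal M T D := by
  obtain ⟨D₀, hD₀⟩ := I.exists_dualFeasible M T
  obtain ⟨D, hD, hmin⟩ := exists_forall_le_of_bddBelow_polyhedron (dualIndices n T) (I.dualForm M)
    I.dualBound (objectiveForm M) ⟨D₀, forall_dualBound_le_dualForm_iff.2 hD₀.relaxed⟩ <| by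
      refine ⟨0, ?_⟩
      rintro _ ⟨D, hD, rfl⟩
      have hD := forall_dualBound_le_dualForm_iff.1 hD
      rw [objectiveForm_apply, dualObjective]
      exact add_nonneg (mul_nonneg M.cast_nonneg hD.lam_nonneg)
        (sum_nonneg fun i _ => hD.h_nonneg i)
  refine ⟨I.truncate D, (forall_dualBound_le_dualForm_iff.1 hD).dualFeasible_truncate,
    fun D' hD' => ?_⟩
  have := hmin D' (forall_dualBound_le_dualForm_iff.2 hD'.relaxed)
  rwa [objectiveForm_apply, objectiveForm_apply] at this

/-- Nonnegative multipliers of the constraints of the relaxed dual that combine them to the dual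
objective. They extend a primal point by the multipliers of the sign constraints; `ω` is the
difference of the multipliers of the two halves of the balance constraint. -/
structure DualMultipliers (I : ProbeBandit n) (M T : ℕ) extends PrimalPoint n where
  lam : ℝ
  h : Fin n → ℝ
  φ : Fin n → Bool → ℕ → ℝ
  x_nonneg : ∀ i s t, 0 ≤ x i s t
  z_nonneg : ∀ i s t, 0 ≤ z i s t
  lam_nonneg : 0 ≤ lam
  h_nonneg : ∀ i, 0 ≤ h i
  φ_nonneg : ∀ i s t, 0 ≤ φ i s t
  objective_eq : ∀ D : DualPoint n, dualObjective M D = lam * D.lam + ∑ i, h i * D.h i +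
    (∑ i, ∑ s, ∑ t ∈ Icc 1 T, φ i s t * D.φ i s t) +
    (∑ i, ∑ s, ∑ t ∈ Icc 1 T, x i s t * (D.lam + D.φ i s t)) +
    (∑ i, ∑ s, ∑ t ∈ Icc 1 T, z i s t *
      (t * D.h i - I.gain i s t * D.p i - ∑ l ∈ Icc 1 t, D.φ i s l)) +
    ω * (M * D.lam - ∑ i, D.h i)

theorem exists_dualMultipliers {d : ℝ} (hd : ∀ D, I.DualFeasible M T D → d ≤ dualObjective M D) :
    ∃ W : DualMultipliers I M T, d ≤ I.primalObjective T W.toPrimalPoint := by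
  obtain ⟨D₀, hD₀⟩ := I.exists_dualFeasible M T
  obtain ⟨w, hw, hobj, hdw⟩ := affine_farkas (dualIndices n T) (I.dualForm M) I.dualBound
    (objectiveForm M) d ⟨D₀, forall_dualBound_le_dualForm_iff.2 hD₀.relaxed⟩ fun D hD => by
      rw [objectiveForm_apply]
      exact hd (I.truncate D) (forall_dualBound_le_dualForm_iff.1 hD).dualFeasible_truncate
  refine ⟨{
    x := fun i s t => w (.inr (.inr (.inr (.inl (i, s, t)))))
    z := fun i s t => w (.inr (.inr (.inr (.inr (.inl (i, s, t))))))
    ω := w (.inr (.inr (.inr (.inr (.inr true))))) - w (.inr (.inr (.inr (.inr (.inr false)))))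
    lam := w (.inl ())
    h := fun i => w (.inr (.inl i))
    φ := fun i s t => w (.inr (.inr (.inl (i, s, t))))
    x_nonneg := fun _ _ _ => hw _
    z_nonneg := fun _ _ _ => hw _
    lam_nonneg := hw _
    h_nonneg := fun _ => hw _
    φ_nonneg := fun _ _ _ => hw _
    objective_eq := fun D => ?_ }, ?_⟩
  · rw [← objectiveForm_apply, hobj]
    simp only [dualIndices, sum_disjSum, sum_product, univ_unique, sum_singleton,
      PUnit.default_eq_unit, dualForm,
      Fintype.sum_bool (f := fun b => w (.inr (.inr (.inr (.inr (.inr b))))) • _),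
      LinearMap.add_apply, LinearMap.sub_apply, LinearMap.smul_apply, LinearMap.sum_apply,
      smul_eq_mul, lamForm_apply, hForm_apply, pForm_apply, φForm_apply]
    ring
  · simp only [dualIndices, sum_disjSum, sum_product, dualBound, mul_zero, sum_const_zero, zero_add,
      add_zero] at hdw
    refine hdw.trans_eq ?_
    simp only [primalObjective_eq, mul_neg, sum_neg_distrib, sub_eq_add_neg, sum_add_distrib,
      mul_comm (I.c _)]

theorem sum_sum_sum_mul_single {ι κ τ : Type*} [Fintype ι] [Fintype κ] [DecidableEq ι]
    [DecidableEq κ] [DecidableEq τ] {r : Finset τ} (f : ι → κ → τ → ℝ) (i : ι) (s : κ) {t : τ}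
    (ht : t ∈ r) :
    ∑ i', ∑ s', ∑ t' ∈ r, f i' s' t' * (if i' = i ∧ s' = s ∧ t' = t then 1 else 0) = f i s t := by
  simp only [ite_and, mul_ite, mul_one, mul_zero, sum_ite_irrel, sum_const_zero, sum_ite_eq',
    mem_univ, if_true, ht]

namespace DualMultipliers

variable (W : DualMultipliers I M T)

theorem plays :
    ∑ i, ∑ t ∈ Icc 1 T, (W.x i true t + W.x i false t) ≤ M * (1 - W.ω) := by
  have := W.objective_eq ⟨1, 0, 0, 0⟩
  simp only [dualObjective, mul_one, Pi.zero_apply, sum_const_zero, add_zero, mul_zero,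
    Fintype.sum_bool, sum_add_distrib, sub_self, sub_zero] at this
  simp only [sum_add_distrib]
  linarith [W.lam_nonneg]

theorem time (i : Fin n) :
    ∑ t ∈ Icc 1 T, t * (W.z i true t + W.z i false t) ≤ 1 + W.ω := by
  have := W.objective_eq ⟨0, Pi.single i 1, 0, 0⟩
  simp only [dualObjective, mul_zero, Pi.single_apply, sum_ite_eq', mem_univ, if_true, zero_add,
    mul_ite, mul_one, Fintype.sum_bool, Pi.zero_apply, sum_const_zero, add_zero, sub_zero,
    sum_ite_irrel, zero_sub, mul_neg] at this
  simp only [mul_comm (Nat.cast _), add_mul, sum_add_distrib]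
  linarith [W.h_nonneg i]

theorem play_le (i : Fin n) (s : Bool) {t : ℕ} (ht : t ∈ Icc 1 T) :
    W.x i s t ≤ ∑ l ∈ Icc t T, W.z i s l := by
  have := W.objective_eq
    ⟨0, 0, 0, fun i' s' t' => if i' = i ∧ s' = s ∧ t' = t then 1 else 0⟩
  simp only [dualObjective, Pi.zero_apply, sum_const_zero, mul_zero, zero_add, sub_zero,
    zero_sub, mul_neg, sum_neg_distrib, sum_mul_sum_Icc, add_zero,
    sum_sum_sum_mul_single _ _ _ ht] at this
  simp only [mul_comm (ite _ _ _), sum_sum_sum_mul_single _ _ _ ht] at this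
  linarith [W.φ_nonneg i s t]

theorem flow (i : Fin n) : ∑ t ∈ Icc 1 T, (1 - I.u i t) * W.z i true t =
    ∑ t ∈ Icc 1 T, I.v i t * W.z i false t := by
  have := W.objective_eq ⟨0, 0, Pi.single i 1, 0⟩
  simp only [dualObjective, mul_zero, Pi.zero_apply, sum_const_zero, add_zero, Fintype.sum_bool,
    gain, Pi.single_apply, mul_ite, mul_one, zero_sub, sub_zero, mul_neg, sum_neg_distrib,
    sum_ite_irrel, goodProb_true, if_true, goodProb_false, Bool.false_eq_true, if_false,
    sum_ite_eq', mem_univ, zero_add, sub_self] at this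
  simp only [mul_comm _ (W.z _ _ _), ← neg_sub (I.u i _) 1, mul_neg, sum_neg_distrib]
  linarith

theorem primalFeasible : I.PrimalFeasible M T W.toPrimalPoint where
  x_nonneg i s t _ := W.x_nonneg i s t
  z_nonneg i s t _ := W.z_nonneg i s t
  plays := W.plays
  time := W.time
  play_le i s _ ht := W.play_le i s ht
  flow := W.flow

end DualMultipliers

theorem exists_primalFeasible_le {d : ℝ}
    (hd : ∀ D, I.DualFeasible M T D → d ≤ dualObjective M D) :
    ∃ P, I.PrimalFeasible M T P ∧ d ≤ I.primalObjective T P := by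
  obtain ⟨W, hW⟩ := exists_dualMultipliers hd
  exact ⟨_, W.primalFeasible, hW⟩

variable (I M T) in
theorem exists_primalOptimal : ∃ P, I.PrimalOptimal M T P := by
  obtain ⟨D, hD, hmin⟩ := I.exists_dualOptimal M T
  obtain ⟨P, hP, h⟩ := exists_primalFeasible_le hmin
  exact ⟨P, hP, fun P' hP' => (weak_duality hP' hD).trans h⟩

theorem strong_duality {P : PrimalPoint n} (hP : I.PrimalOptimal M T P)
    (hD : I.DualOptimal M T D) : I.primalObjective T P = dualObjective M D := by
  obtain ⟨P', hP', h⟩ := exists_primalFeasible_le hD.2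
  exact (weak_duality hP.1 hD.1).antisymm (h.trans (hP.2 P' hP'))

end StrongDuality

end ProbeBandit

section FinsetSums

theorem sum_mul_pos_iff {ι : Type*} {r : Finset ι} {w f : ι → ℝ} (hw : ∀ t ∈ r, 0 < w t)
    (hf : ∀ t ∈ r, 0 ≤ f t) : 0 < ∑ t ∈ r, w t * f t ↔ ∃ t ∈ r, 0 < f t := by
  rw [sum_pos_iff_of_nonneg fun t ht => mul_nonneg (hw t ht).le (hf t ht)]
  exact exists_congr fun t => and_congr_right fun ht => mul_pos_iff_of_pos_left (hw t ht)

theorem filter_Icc_one_eq_Ico {d : ℕ} {p : ℕ → Prop} [DecidablePred p]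
    (hp : ∀ l ∈ Icc 1 d, ∀ l' ∈ Icc l d, p l → p l') :
    {l ∈ Icc 1 d | p l} = Ico (d - #{l ∈ Icc 1 d | p l} + 1) (d + 1) := by
  have hcard : #{l ∈ Icc 1 d | p l} ≤ d := (card_filter_le _ _).trans (by simp)
  refine eq_of_subset_of_card_le (fun l hl => ?_) ?_
  · obtain ⟨hl, hpl⟩ := mem_filter.1 hl
    have hsub : Icc l d ⊆ {l ∈ Icc 1 d | p l} := fun l' hl' =>
      mem_filter.2 ⟨Icc_subset_Icc_left (mem_Icc.1 hl).1 hl', hp l hl l' hl' hpl⟩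
    have := card_le_card hsub
    rw [Nat.card_Icc] at this
    simp only [mem_Icc, mem_Ico] at hl ⊢
    omega
  · rw [Nat.card_Ico]
    omega

end FinsetSums

namespace ProbeBandit

variable {n : ℕ}

section OptimalSolutions

variable {I : ProbeBandit n} {M T : ℕ} {P : PrimalPoint n} {D : DualPoint n} {i : Fin n}

theorem PrimalFeasible.primalObjective_nonpos (hP : I.PrimalFeasible M T P) (hω : 1 + P.ω ≤ 0) :
    I.primalObjective T P ≤ 0 := by
  have hz : ∀ i s, ∀ t ∈ Icc 1 T, P.z i s t = 0 := fun i s t ht => by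
    have hsum := (sum_mul_pos_iff (fun t ht => Nat.cast_pos.2 (mem_Icc.1 ht).1)
      fun t ht => add_nonneg (hP.z_nonneg i true t ht) (hP.z_nonneg i false t ht)).not.1
      ((hP.time i).trans hω).not_gt
    push Not at hsum
    have := hsum t ht
    cases s <;> linarith [hP.z_nonneg i true t ht, hP.z_nonneg i false t ht]
  rw [primalObjective_eq]
  refine sum_nonpos fun i _ => sum_nonpos fun s _ => sum_nonpos fun t ht => ?_
  have hx : P.x i s t ≤ 0 := (hP.play_le i s t ht).trans <|
    sum_nonpos fun l hl => (hz i s l (Icc_subset_Icc_left (mem_Icc.1 ht).1 hl)).le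
  rw [hz i s t ht, mul_zero, sub_zero]
  exact mul_nonpos_of_nonpos_of_nonneg hx (I.R_nonneg i s t)

theorem DualFeasible.dualObjective_eq (hD : I.DualFeasible M T D) :
    dualObjective M D = 2 * ∑ i, D.h i := by
  rw [dualObjective, hD.balance, two_mul]

theorem PrimalFeasible.exists_z_pos_iff (hP : I.PrimalFeasible M T P) (i : Fin n) :
    (∃ t ∈ Icc 1 T, 0 < P.z i true t) ↔ ∃ t ∈ Icc 1 T, 0 < P.z i false t := by
  rw [← sum_mul_pos_iff (fun t ht => sub_pos.2 (I.u_lt_one i (mem_Icc.1 ht).1))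
      (hP.z_nonneg i true), hP.flow i,
    sum_mul_pos_iff (fun t ht => I.v_pos i (mem_Icc.1 ht).1) (hP.z_nonneg i false)]

theorem exists_z_pos (hP : I.PrimalOptimal M T P) (hD : I.DualOptimal M T D) (hi : 0 < D.h i)
    (s : Bool) : ∃ t ∈ Icc 1 T, 0 < P.z i s t := by
  have hval := strong_duality hP hD
  have htime : P.timeSlack T i = 0 :=
    (complementarySlack_of_objective_eq hP.1 hD.1 hval).time i hi.ne'
  have hω : 0 < 1 + P.ω := by
    by_contra! hω
    have hobj := hP.1.primalObjective_nonpos hω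
    rw [hval, hD.1.dualObjective_eq] at hobj
    linarith [single_le_sum (fun j _ => hD.1.h_nonneg j) (mem_univ i)]
  have hsum : 0 < ∑ s, ∑ t ∈ Icc 1 T, (t : ℝ) * P.z i s t := by
    rw [PrimalPoint.timeSlack] at htime
    linarith
  obtain ⟨s', -, hs'⟩ := exists_lt_of_sum_lt (sum_const_zero.trans_lt hsum)
  rw [sum_mul_pos_iff (fun t ht => Nat.cast_pos.2 (mem_Icc.1 ht).1) (hP.1.z_nonneg i s')] at hs'
  have hiff := hP.1.exists_z_pos_iff i
  cases s <;> cases s'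
  exacts [hs', hiff.1 hs', hiff.2 hs', hs']

theorem probeSlack_succ (D : DualPoint n) (i : Fin n) (s : Bool) (t : ℕ) :
    I.probeSlack D i s (t + 1) = I.probeSlack D i s t + D.h i -
      (I.goodProb i s (t + 1) - I.goodProb i s t) * D.p i - D.φ i s (t + 1) := by
  rw [probeSlack, probeSlack, sum_Icc_succ_top (by omega), gain, gain]
  push_cast
  ring

theorem DualFeasible.φ_true_pos (hD : I.DualFeasible M T D) (hi : 0 < D.h i) {t : ℕ}
    (ht : t ∈ Icc 1 T) (htight : I.probeSlack D i true t = 0) : 0 < D.φ i true t := by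
  obtain ⟨k, rfl⟩ := Nat.exists_eq_add_of_le' (mem_Icc.1 ht).1
  have hk := hD.probeSlack_nonneg i true (k.le_succ.trans (mem_Icc.1 ht).2)
  have hp := mul_le_mul_of_nonneg_right (I.u_anti i k.le_succ) (hD.p_nonneg i)
  rw [probeSlack_succ, goodProb_true, goodProb_true, Nat.succ_eq_add_one] at *
  linarith

theorem ComplementarySlack.φ_eq (hs : ComplementarySlack I T P D) (hP : I.PrimalFeasible M T P)
    {s : Bool} {t l : ℕ} (ht : t ∈ Icc 1 T) (hz : 0 < P.z i s t) (hl : l ∈ Icc 1 t)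
    (hφ : D.φ i s l ≠ 0) : D.φ i s l = I.R i s l - D.lam := by
  have hlT : l ∈ Icc 1 T := Icc_subset_Icc_right (mem_Icc.1 ht).2 hl
  have hcount := hs.playCount i s l hlT hφ
  have hzx : P.z i s t ≤ ∑ l ∈ Icc l T, P.z i s l :=
    single_le_sum (fun k hk => hP.z_nonneg i s k (Icc_subset_Icc_left (mem_Icc.1 hl).1 hk))
      (mem_Icc.2 ⟨(mem_Icc.1 hl).2, (mem_Icc.1 ht).2⟩)
  rw [PrimalPoint.playCountSlack] at hcount
  have hplay := hs.play i s l hlT (by linarith)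
  rw [playSlack] at hplay
  linarith

theorem ComplementarySlack.φ_true_eq (hs : ComplementarySlack I T P D)
    (hP : I.PrimalFeasible M T P) (hD : I.DualFeasible M T D) (hi : 0 < D.h i) {e l : ℕ}
    (he : e ∈ Icc 1 T) (hz : 0 < P.z i true e) (hl : l ∈ Icc 1 e) :
    D.φ i true l = I.R i true l - D.lam := by
  have hφe := hD.φ_true_pos hi he (hs.probe i true e he hz.ne')
  have hφe_eq := hs.φ_eq hP he hz (right_mem_Icc.2 (mem_Icc.1 he).1) hφe.ne'
  have hR := I.R_true_anti i (mem_Icc.1 hl).2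
  have hplay := hD.play i true l (Icc_subset_Icc_right (mem_Icc.1 he).2 hl)
  exact hs.φ_eq hP he hz hl (by linarith)

theorem ComplementarySlack.good_eq (hs : ComplementarySlack I T P D)
    (hP : I.PrimalFeasible M T P) (hD : I.DualFeasible M T D) (hi : 0 < D.h i) {e : ℕ}
    (he : e ∈ Icc 1 T) (hz : 0 < P.z i true e) :
    -I.c i + I.u i e * D.p i + ∑ l ∈ range e, (I.R i true (l + 1) - D.lam) =
      D.p i + e * D.h i := by
  have htight := hs.probe i true e he hz.ne'
  rw [probeSlack, gain, goodProb_true, if_pos rfl,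
    sum_congr rfl fun l hl => hs.φ_true_eq hP hD hi he hz hl, ← Ico_add_one_right_eq_Icc,
    sum_Ico_eq_sum_range, Nat.add_sub_cancel] at htight
  simp only [add_comm 1] at htight
  linarith

theorem ComplementarySlack.φ_false_pos_of_le (hs : ComplementarySlack I T P D)
    (hP : I.PrimalFeasible M T P) (hD : I.DualFeasible M T D) {d l l' : ℕ} (hd : d ∈ Icc 1 T)
    (hz : 0 < P.z i false d) (hl : l ∈ Icc 1 d) (hl' : l' ∈ Icc l d) (hφ : 0 < D.φ i false l) :
    0 < D.φ i false l' := by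
  have hφ_eq := hs.φ_eq hP hd hz hl hφ.ne'
  have hR := I.R_false_mono i (mem_Icc.1 hl').1
  have hplay := hD.play i false l' <|
    Icc_subset_Icc (mem_Icc.1 hl).1 (mem_Icc.1 hd).2 hl'
  linarith

theorem ComplementarySlack.sum_φ_false_eq (hs : ComplementarySlack I T P D)
    (hP : I.PrimalFeasible M T P) (hD : I.DualFeasible M T D) {d : ℕ} (hd : d ∈ Icc 1 T)
    (hz : 0 < P.z i false d) :
    ∑ l ∈ Icc 1 d, D.φ i false l = ∑ l ∈ {l ∈ Icc 1 d | 0 < D.φ i false l},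
      (I.R i false l - D.lam) := by
  rw [← sum_filter_of_ne (p := fun l => 0 < D.φ i false l)]
  · refine sum_congr rfl fun l hl => ?_
    obtain ⟨hl, hφ⟩ := mem_filter.1 hl
    exact hs.φ_eq hP hd hz hl hφ.ne'
  · exact fun l hl hne =>
      (hD.φ_nonneg i false l (Icc_subset_Icc_right (mem_Icc.1 hd).2 hl)).lt_of_ne' hne

theorem ComplementarySlack.bad_eq (hs : ComplementarySlack I T P D)
    (hP : I.PrimalFeasible M T P) (hD : I.DualFeasible M T D) {d m : ℕ} (hd : d ∈ Icc 1 T)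
    (hz : 0 < P.z i false d) (hm : #{l ∈ Icc 1 d | 0 < D.φ i false l} = m) :
    -I.c i + I.v i d * D.p i + ∑ l ∈ range m, (I.R i false (d - m + l + 1) - D.lam) =
      d * D.h i := by
  have hmd : m ≤ d := hm ▸ (card_filter_le _ _).trans (by simp)
  have htight := hs.probe i false d hd hz.ne'
  rw [probeSlack, gain, goodProb_false, if_neg Bool.false_ne_true, sub_zero,
    hs.sum_φ_false_eq hP hD hd hz, filter_Icc_one_eq_Ico fun l hl l' hl' =>
      hs.φ_false_pos_of_le hP hD hd hz hl hl', hm, sum_Ico_eq_sum_range,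
    show d + 1 - (d - m + 1) = m by omega] at htight
  simp only [add_right_comm _ 1] at htight
  linarith

/-- What the analysis of the two-stage policy uses about an arm `i`: the probes that end the two
stages are tight at the prices `D`. -/
structure TightStages (I : ProbeBandit n) (D : DualPoint n) (q : StageParams n) (i : Fin n) :
    Prop where
  one_le_d : 1 ≤ q.d i
  one_le_e : 1 ≤ q.e i
  m_le_d : q.m i ≤ q.d i
  h_nonneg : 0 ≤ D.h i
  p_nonneg : 0 ≤ D.p i
  good : -I.c i + I.u i (q.e i) * D.p i + ∑ l ∈ range (q.e i), (I.R i true (l + 1) - D.lam) =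
    D.p i + q.e i * D.h i
  bad : -I.c i + I.v i (q.d i) * D.p i +
      ∑ l ∈ range (q.m i), (I.R i false (q.d i - q.m i + l + 1) - D.lam) = q.d i * D.h i

theorem tightStages (hP : I.PrimalOptimal M T P) (hD : I.DualOptimal M T D) (hi : 0 < D.h i) :
    I.TightStages D (stageParams T P D) i := by
  have hs := complementarySlack_of_objective_eq hP.1 hD.1 (strong_duality hP hD)
  obtain ⟨he, hze⟩ : (stageParams T P D).e i ∈ {t | t ∈ Icc 1 T ∧ 0 < P.z i true t} :=
    Nat.sInf_mem (exists_z_pos hP hD hi true)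
  obtain ⟨hd, hzd⟩ : (stageParams T P D).d i ∈ {t | t ∈ Icc 1 T ∧ 0 < P.z i false t} :=
    Nat.sInf_mem (exists_z_pos hP hD hi false)
  exact {
    one_le_d := (mem_Icc.1 hd).1
    one_le_e := (mem_Icc.1 he).1
    m_le_d := (card_filter_le _ _).trans (Nat.card_Icc 1 _).le
    h_nonneg := hi.le
    p_nonneg := hD.1.p_nonneg i
    good := hs.good_eq hP.1 hD.1 hi he hze
    bad := hs.bad_eq hP.1 hD.1 hd hzd rfl }

end OptimalSolutions

end ProbeBandit

/-- The last observed state of an arm; the start states `s₀` count as observed. -/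
def lastObs {n : ℕ} (s₀ : Fin n → Bool) : History n → Fin n → Bool
  | [], i => s₀ i
  | .played _ :: h, i => lastObs s₀ h i
  | .probed a good :: h, i => if i = a then good else lastObs s₀ h i

/-- The number of time steps since the last observation of an arm. -/
def age {n : ℕ} : History n → Fin n → ℕ
  | [], _ => 0
  | .played _ :: h, i => age h i + 1
  | .probed a _ :: h, i => if i = a then 0 else age h i

section Observations

variable {n : ℕ} (s₀ : Fin n → Bool) (h : History n) (i : Fin n) (g : Bool)

theorem lastObs_probed :
    lastObs s₀ (.probed i g :: h) = Function.update (lastObs s₀ h) i g := by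
  funext j
  rw [Function.update_apply, lastObs]

theorem age_probed : age (.probed i g :: h) = Function.update (age h) i 0 := by
  funext j
  rw [Function.update_apply, age]

end Observations

theorem sum_toReal_mul_le_of_forall_mem_support {A : Type*} [Fintype A] (p : PMF A) {f : A → ℝ}
    {y : ℝ} (h : ∀ a ∈ p.support, f a ≤ y) : ∑ a, (p a).toReal * f a ≤ y := by
  have hsum : ∑ a, (p a).toReal = 1 := by
    rw [← ENNReal.toReal_sum fun a _ => p.apply_ne_top a, ← tsum_fintype (L := .unconditional _),
      p.tsum_coe, ENNReal.toReal_one]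
  calc ∑ a, (p a).toReal * f a ≤ ∑ a, (p a).toReal * y := by
        refine sum_le_sum fun a _ => ?_
        by_cases ha : a ∈ p.support
        · exact mul_le_mul_of_nonneg_left (h a ha) ENNReal.toReal_nonneg
        · simp [(p.apply_eq_zero_iff a).2 ha]
    _ = y := by rw [← sum_mul, hsum, one_mul]

namespace ProbeBandit

variable {n : ℕ} (I : ProbeBandit n)

section JointStateProbabilities

/-- Probability that arm `i` is in state `s` when it was observed in state `o` exactly `t` steps
ago. -/
def stateProb (i : Fin n) (o : Bool) (t : ℕ) (s : Bool) : ℝ :=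
  if s then I.goodProb i o t else 1 - I.goodProb i o t

theorem sum_stateProb (i : Fin n) (o : Bool) (t : ℕ) : ∑ s, I.stateProb i o t s = 1 := by
  simp [stateProb]

theorem stateProb_nonneg (i : Fin n) (o : Bool) (t : ℕ) (s : Bool) : 0 ≤ I.stateProb i o t s := by
  cases s
  exacts [sub_nonneg.2 (I.goodProb_le_one i o t), I.goodProb_nonneg i o t]

theorem stateProb_zero (i : Fin n) (o s : Bool) :
    I.stateProb i o 0 s = if s = o then 1 else 0 := by
  cases o <;> cases s <;> simp [stateProb, goodProb_zero]

theorem stateProb_succ (i : Fin n) (o : Bool) (t : ℕ) (s' : Bool) :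
    I.stateProb i o (t + 1) s' = ∑ s, I.stateProb i o t s * I.stateProb i s 1 s' := by
  simp only [stateProb, I.goodProb_succ i o t, Fintype.sum_bool, goodProb_true, goodProb_false,
    u_one, v_one, if_true, Bool.false_eq_true, if_false]
  split_ifs <;> ring

/-- Probability of the joint state `s` when each arm `i` was observed in state `o i` exactly `t i`
steps ago. -/
def jointProb (o : Fin n → Bool) (t : Fin n → ℕ) (s : Fin n → Bool) : ℝ :=
  ∏ i, I.stateProb i (o i) (t i) (s i)

theorem trans_eq_jointProb (s s' : Fin n → Bool) : I.trans s s' = I.jointProb s 1 s' := by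
  refine prod_congr rfl fun i _ => ?_
  cases s i <;> cases s' i <;> simp [stateProb, u_one, v_one]

theorem sum_jointProb (o : Fin n → Bool) (t : Fin n → ℕ) : ∑ s, I.jointProb o t s = 1 := by
  rw [← Fintype.piFinset_univ]
  exact (prod_univ_sum _ _).symm.trans (prod_eq_one fun i _ => I.sum_stateProb _ _ _)

theorem sum_jointProb_mul_trans (o : Fin n → Bool) (t : Fin n → ℕ) (s' : Fin n → Bool) :
    ∑ s, I.jointProb o t s * I.trans s s' = I.jointProb o (t + 1) s' := by
  simp only [trans_eq_jointProb, jointProb, ← prod_mul_distrib]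
  rw [← Fintype.piFinset_univ]
  have hprod := prod_univ_sum (fun _ => univ)
    fun i b => I.stateProb i (o i) (t i) b * I.stateProb i b 1 (s' i)
  exact hprod.symm.trans (prod_congr rfl fun i _ => (I.stateProb_succ _ _ _ _).symm)

theorem jointProb_update (o : Fin n → Bool) (t : Fin n → ℕ) (i : Fin n) (g : Bool)
    (s : Fin n → Bool) :
    I.jointProb (Function.update o i g) (Function.update t i 0) s =
      (if s i = g then 1 else 0) * ∏ j ∈ univ.erase i, I.stateProb j (o j) (t j) (s j) := by
  rw [jointProb, ← mul_prod_erase univ _ (mem_univ i), Function.update_self, Function.update_self,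
    stateProb_zero]
  congr 1
  refine prod_congr rfl fun j hj => ?_
  rw [Function.update_of_ne (ne_of_mem_erase hj), Function.update_of_ne (ne_of_mem_erase hj)]

theorem sum_jointProb_mul (o : Fin n → Bool) (t : Fin n → ℕ) (i : Fin n)
    (f : Bool → (Fin n → Bool) → ℝ) :
    ∑ s, I.jointProb o t s * f (s i) s = ∑ g, I.stateProb i (o i) (t i) g *
      ∑ s, I.jointProb (Function.update o i g) (Function.update t i 0) s * f g s := by
  simp only [mul_sum]
  rw [sum_comm]
  refine sum_congr rfl fun s _ => ?_
  simp only [jointProb_update, ite_mul, one_mul, zero_mul, mul_ite, mul_zero, sum_ite_eq, mem_univ,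
    if_true]
  rw [jointProb, ← mul_prod_erase univ _ (mem_univ i), mul_assoc]

end JointStateProbabilities

section ExpectedValues

variable (s₀ : Fin n → Bool) {M : ℕ} (π : Policy n M)

/-- Probability of the outcome `g` of a probe of arm `i` after the history `h`. -/
def probeProb (h : History n) (i : Fin n) (g : Bool) : ℝ :=
  I.stateProb i (lastObs s₀ h i) (age h i) g

theorem sum_probeProb_mul (h : History n) (i : Fin n) (f : Bool → ℝ) :
    ∑ g, I.probeProb s₀ h i g * f g =
      f false + I.goodProb i (lastObs s₀ h i) (age h i) * (f true - f false) := by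
  simp only [probeProb, stateProb, Fintype.sum_bool, if_true, Bool.false_eq_true, if_false]
  ring

/-- Expected value of the next `k` time steps, given the history. -/
def expValue (k : ℕ) (h : History n) : ℝ :=
  ∑ s, I.jointProb (lastObs s₀ h) (age h + 1) s * I.valueToGo π k h s

/-- Expected value of the rest of the time step, when at most `j` further probes can be made, and
of the `k` time steps that follow, given the history. -/
def expProbeValue (k j : ℕ) (h : History n) : ℝ :=
  ∑ s, I.jointProb (lastObs s₀ h) (age h) s *
    I.probeValue π s (fun h' => ∑ s', I.trans s s' * I.valueToGo π k h' s') j h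

theorem averageValue_eq (k : ℕ) : I.averageValue π s₀ k = I.expValue s₀ π k [] / k := by
  simp only [averageValue, trans_eq_jointProb]
  rfl

theorem sum_jointProb_mul_sum_trans (k : ℕ) (h : History n) :
    ∑ s, I.jointProb (lastObs s₀ h) (age h) s * ∑ s', I.trans s s' * I.valueToGo π k h s' =
      I.expValue s₀ π k h := by
  simp only [expValue, ← sum_jointProb_mul_trans, mul_sum, sum_mul, mul_assoc]
  exact sum_comm

theorem expProbeValue_zero (k : ℕ) (h : History n) :
    I.expProbeValue s₀ π k 0 h = I.expValue s₀ π k h :=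
  I.sum_jointProb_mul_sum_trans s₀ π k h

theorem expProbeValue_succ (k j : ℕ) (h : History n) :
    I.expProbeValue s₀ π k (j + 1) h = ∑ o, (π.probe h o).toReal * match o with
      | none => I.expValue s₀ π k h
      | some i => ∑ g, I.probeProb s₀ h i g *
          (-I.c i + I.expProbeValue s₀ π k j (.probed i g :: h)) := by
  simp only [expProbeValue, probeValue, mul_sum]
  rw [sum_comm]
  refine sum_congr rfl fun o _ => ?_
  simp only [mul_left_comm (I.jointProb _ _ _), ← mul_sum]
  congr 1
  cases o with
  | none => exact I.sum_jointProb_mul_sum_trans s₀ π k h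
  | some i =>
    refine (I.sum_jointProb_mul (lastObs s₀ h) (age h) i fun g s => -I.c i + I.probeValue π s
      (fun h' => ∑ s', I.trans s s' * I.valueToGo π k h' s') j (.probed i g :: h)).trans ?_
    simp only [mul_add, sum_add_distrib, ← sum_mul, sum_jointProb, one_mul, lastObs_probed,
      age_probed, probeProb]

theorem sum_jointProb_mul_reward (o : Fin n → Bool) (t : Fin n → ℕ) (i : Fin n) :
    (∑ s, I.jointProb o t s * if s i then I.r i else 0) = I.R i (o i) (t i) := by
  rw [I.sum_jointProb_mul o t i fun g _ => if g then I.r i else 0]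
  simp only [← sum_mul, sum_jointProb, one_mul, Fintype.sum_bool, stateProb, if_true,
    Bool.false_eq_true, if_false, mul_zero, add_zero]
  exact mul_comm _ _

theorem expValue_succ (k : ℕ) (h : History n) :
    I.expValue s₀ π (k + 1) h = ∑ A, (π.play h A).toReal *
      ((∑ i ∈ A, I.R i (lastObs s₀ h i) (age h i + 1)) +
        I.expProbeValue s₀ π k n (.played A :: h)) := by
  simp only [expValue, valueToGo, mul_sum]
  rw [sum_comm]
  refine sum_congr rfl fun A _ => ?_
  simp only [mul_left_comm (I.jointProb _ _ _), ← mul_sum, mul_add, sum_add_distrib]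
  congr 2
  simp only [mul_sum]
  rw [sum_comm]
  exact sum_congr rfl fun i _ => I.sum_jointProb_mul_reward (lastObs s₀ h) (age h + 1) i

end ExpectedValues

section PotentialMethod

variable {I} {s₀ : Fin n → Bool} {M : ℕ} {π : Policy n M} {F : History n → ℝ} {σ : ℝ}

theorem expProbeValue_potential {k : ℕ} {C : ℝ}
    (hcont : ∀ h, Visits π none h → σ * I.expValue s₀ π k h ≤ C + σ * F h)
    (hprobe : ∀ j h, Visits π (some (j + 1)) h → ∀ i, some i ∈ (π.probe h).support →
      σ * (-I.c i + ∑ g, I.probeProb s₀ h i g * F (.probed i g :: h)) ≤ σ * F h)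
    (j : ℕ) (h : History n) (hv : Visits π (some j) h) :
    σ * I.expProbeValue s₀ π k j h ≤ C + σ * F h := by
  induction j generalizing h with
  | zero =>
    rw [expProbeValue_zero]
    exact hcont h (.last hv)
  | succ j ih =>
    rw [expProbeValue_succ, mul_sum]
    simp only [mul_left_comm σ]
    refine sum_toReal_mul_le_of_forall_mem_support _ fun o ho => ?_
    cases o with
    | none => exact hcont h (.finish hv ho)
    | some i =>
      have hsum : ∑ g, I.probeProb s₀ h i g = 1 := I.sum_stateProb _ _ _
      calc σ * ∑ g, I.probeProb s₀ h i g *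
              (-I.c i + I.expProbeValue s₀ π k j (.probed i g :: h))
          = -σ * I.c i + ∑ g, I.probeProb s₀ h i g *
              (σ * I.expProbeValue s₀ π k j (.probed i g :: h)) := by
            simp only [mul_add, sum_add_distrib, ← sum_mul, hsum, mul_left_comm _ σ, ← mul_sum]
            ring
        _ ≤ -σ * I.c i + ∑ g, I.probeProb s₀ h i g * (C + σ * F (.probed i g :: h)) := by
            gcongr with g
            · exact I.stateProb_nonneg _ _ _ _
            · exact ih _ (.probe g hv ho)
        _ = C + σ * (-I.c i + ∑ g, I.probeProb s₀ h i g * F (.probed i g :: h)) := by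
            simp only [mul_add, sum_add_distrib, ← sum_mul, hsum, mul_left_comm _ σ, ← mul_sum]
            ring
        _ ≤ C + σ * F h := add_le_add_right (hprobe j h hv i ho) C

/-- If every decision changes the value collected plus the potential `F` by at most (`σ = 1`), or at
least (`σ = -1`), `κ` per time step, then so does the policy, up to the bound `K` on the potential
at the end. -/
theorem expValue_potential (κ K : ℝ)
    (hplay : ∀ h, Visits π none h → ∀ A ∈ (π.play h).support,
      σ * ((∑ i ∈ A, I.R i (lastObs s₀ h i) (age h i + 1)) + F (.played A :: h)) ≤ σ * (κ + F h))
    (hprobe : ∀ j h, Visits π (some (j + 1)) h → ∀ i, some i ∈ (π.probe h).support →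
      σ * (-I.c i + ∑ g, I.probeProb s₀ h i g * F (.probed i g :: h)) ≤ σ * F h)
    (hend : ∀ h, Visits π none h → -K ≤ σ * F h) (k : ℕ) (h : History n) (hv : Visits π none h) :
    σ * I.expValue s₀ π k h ≤ σ * (k * κ + F h) + K := by
  induction k generalizing h with
  | zero =>
    have := hend h hv
    simp only [expValue, valueToGo, mul_zero, sum_const_zero, CharP.cast_eq_zero, zero_mul,
      zero_add]
    linarith
  | succ k ih =>
    rw [expValue_succ, mul_sum]
    simp only [mul_left_comm σ]
    refine sum_toReal_mul_le_of_forall_mem_support _ fun A hA => ?_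
    have hcont := expProbeValue_potential (C := σ * (k * κ) + K)
      (fun h hv => (ih h hv).trans_eq (by ring)) hprobe n _ (.play hv hA)
    have hstep := hplay h hv A hA
    push_cast
    linarith

end PotentialMethod

end ProbeBandit

section AverageLimits

open Topology

variable {f : ℕ → ℝ} {a C : ℝ}

theorem tendsto_add_div_atTop_nhds (a C : ℝ) : Tendsto (fun k : ℕ => a + C / k) atTop (𝓝 a) := by
  simpa only [add_zero] using (tendsto_const_div_atTop_nhds_zero_nat C).const_add a

theorem isBoundedUnder_of_le_add_div (hf : ∀ k : ℕ, 0 < k → f k ≤ a + C / k) :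
    IsBoundedUnder (· ≤ ·) atTop f :=
  (tendsto_add_div_atTop_nhds a C).isBoundedUnder_le.mono_le <|
    (eventually_gt_atTop 0).mono hf

theorem limsup_le_of_le_add_div (ha : 0 ≤ a) (hf : ∀ k : ℕ, 0 < k → f k ≤ a + C / k) :
    limsup f atTop ≤ a := by
  have hlim := tendsto_add_div_atTop_nhds a C
  by_cases hcob : IsCoboundedUnder (· ≤ ·) atTop f
  · rw [← hlim.limsup_eq]
    exact limsup_le_limsup ((eventually_gt_atTop 0).mono hf) hcob hlim.isBoundedUnder_le
  · -- The upper limit of a sequence that tends to `-∞` is the junk value `0`.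
    exact (Real.sInf_of_not_bddBelow hcob).trans_le ha

theorem le_liminf_of_add_div_le (hbdd : IsBoundedUnder (· ≤ ·) atTop f)
    (hf : ∀ k : ℕ, 0 < k → a + C / k ≤ f k) : a ≤ liminf f atTop := by
  have hlim := tendsto_add_div_atTop_nhds a C
  rw [← hlim.liminf_eq]
  exact liminf_le_liminf ((eventually_gt_atTop 0).mono hf) hlim.isBoundedUnder_ge
    hbdd.isCoboundedUnder_ge

end AverageLimits

namespace ProbeBandit

variable {n : ℕ} {I : ProbeBandit n} {M T : ℕ} {D : DualPoint n}

section ValidPrices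

/-- The constraints of the dual at all times, without the balance constraint. -/
structure ValidPrices (I : ProbeBandit n) (D : DualPoint n) : Prop where
  lam_nonneg : 0 ≤ D.lam
  h_nonneg : ∀ i, 0 ≤ D.h i
  p_nonneg : ∀ i, 0 ≤ D.p i
  φ_nonneg : ∀ i s t, 0 ≤ D.φ i s t
  playSlack_nonneg : ∀ i s t, 0 ≤ I.playSlack D i s t
  probeSlack_nonneg : ∀ i s t, 0 ≤ I.probeSlack D i s t

/-- Potential, at the prices `D`, of an arm `i` that was observed in state `o` exactly `t` steps
ago. -/
def ageValue (D : DualPoint n) (i : Fin n) (o : Bool) (t : ℕ) : ℝ :=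
  (if o then D.p i else 0) + t * D.h i - ∑ l ∈ Icc 1 t, D.φ i o l

theorem ageValue_zero (D : DualPoint n) (i : Fin n) (o : Bool) :
    ageValue D i o 0 = if o then D.p i else 0 := by
  simp [ageValue]

theorem ageValue_succ (D : DualPoint n) (i : Fin n) (o : Bool) (t : ℕ) :
    ageValue D i o (t + 1) = ageValue D i o t + (D.h i - D.φ i o (t + 1)) := by
  rw [ageValue, ageValue, sum_Icc_succ_top (by omega)]
  push_cast
  ring

theorem ageValue_eq (I : ProbeBandit n) (D : DualPoint n) (i : Fin n) (o : Bool) (t : ℕ) :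
    ageValue D i o t = I.probeSlack D i o t + (-I.c i + I.goodProb i o t * D.p i) := by
  rw [ageValue, probeSlack, gain]
  split_ifs <;> ring

theorem ValidPrices.le_ageValue (hD : I.ValidPrices D) (i : Fin n) (o : Bool) (t : ℕ) :
    -I.c i + I.goodProb i o t * D.p i ≤ ageValue D i o t := by
  linarith [I.ageValue_eq D i o t, hD.probeSlack_nonneg i o t]

theorem ValidPrices.play_le (hD : I.ValidPrices D) (o : Fin n → Bool) (t : Fin n → ℕ)
    {A : Finset (Fin n)} (hA : A.card ≤ M) :
    (∑ i ∈ A, I.R i (o i) (t i + 1)) + ∑ i, ageValue D i (o i) (t i + 1) ≤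
      dualObjective M D + ∑ i, ageValue D i (o i) (t i) := by
  have hcard : (A.card : ℝ) * D.lam ≤ M * D.lam := by
    gcongr
    exact hD.lam_nonneg
  have hplay : ∑ i ∈ A, I.R i (o i) (t i + 1) ≤ ∑ i ∈ A, (D.lam + D.φ i (o i) (t i + 1)) :=
    sum_le_sum fun i _ => sub_nonneg.1 (hD.playSlack_nonneg i _ _)
  have hφ : ∑ i ∈ A, D.φ i (o i) (t i + 1) ≤ ∑ i, D.φ i (o i) (t i + 1) :=
    sum_le_sum_of_subset_of_nonneg (subset_univ A) fun i _ _ => hD.φ_nonneg i _ _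
  rw [sum_add_distrib, sum_const, nsmul_eq_mul] at hplay
  simp only [ageValue_succ, sum_add_distrib, sum_sub_distrib, dualObjective]
  linarith

theorem sum_ageValue_probed (D : DualPoint n) (s₀ : Fin n → Bool) (h : History n) (i : Fin n)
    (g : Bool) :
    ∑ j, ageValue D j (lastObs s₀ (.probed i g :: h) j) (age (.probed i g :: h) j) =
      (if g then D.p i else 0) +
        ∑ j ∈ univ.erase i, ageValue D j (lastObs s₀ h j) (age h j) := by
  rw [← add_sum_erase univ _ (mem_univ i), lastObs_probed, age_probed, Function.update_self,
    Function.update_self, ageValue_zero]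
  congr 1
  refine sum_congr rfl fun j hj => ?_
  rw [Function.update_of_ne (ne_of_mem_erase hj), Function.update_of_ne (ne_of_mem_erase hj)]

theorem ValidPrices.probe_le (hD : I.ValidPrices D) (s₀ : Fin n → Bool) (h : History n)
    (i : Fin n) :
    -I.c i + ∑ g, I.probeProb s₀ h i g *
        ∑ j, ageValue D j (lastObs s₀ (.probed i g :: h) j) (age (.probed i g :: h) j) ≤
      ∑ j, ageValue D j (lastObs s₀ h j) (age h j) := by
  simp only [sum_ageValue_probed, sum_probeProb_mul, if_true, Bool.false_eq_true, if_false]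
  rw [← add_sum_erase univ _ (mem_univ i)]
  linarith [hD.le_ageValue i (lastObs s₀ h i) (age h i)]

theorem ValidPrices.expValue_le (hD : I.ValidPrices D) (s₀ : Fin n → Bool) (π : Policy n M)
    (k : ℕ) :
    I.expValue s₀ π k [] ≤
      k * dualObjective M D + ∑ i, ageValue D i (s₀ i) 0 + ∑ i, I.c i := by
  have hend : ∀ h : History n,
      -∑ i, I.c i ≤ ∑ i, ageValue D i (lastObs s₀ h i) (age h i) := by
    intro h
    rw [← sum_neg_distrib]
    refine sum_le_sum fun i _ => le_trans ?_ (hD.le_ageValue i _ _)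
    exact le_add_of_nonneg_right (mul_nonneg (I.goodProb_nonneg i _ _) (hD.p_nonneg i))
  simpa only [one_mul, lastObs, age] using expValue_potential (I := I) (s₀ := s₀) (π := π) (σ := 1)
    (F := fun h => ∑ i, ageValue D i (lastObs s₀ h i) (age h i)) (dualObjective M D) (∑ i, I.c i)
    (fun h _ A hA => by
      simpa only [one_mul, lastObs, age] using hD.play_le (lastObs s₀ h) (age h) (π.card_le h A hA))
    (fun _ h _ i _ => by simpa only [one_mul] using hD.probe_le s₀ h i)
    (fun h _ => by simpa only [one_mul] using hend h) k [] .start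

theorem ValidPrices.exists_averageValue_le (hD : I.ValidPrices D) (π : Policy n M)
    (s₀ : Fin n → Bool) :
    ∃ C, ∀ k : ℕ, 0 < k → I.averageValue π s₀ k ≤ dualObjective M D + C / k := by
  refine ⟨∑ i, ageValue D i (s₀ i) 0 + ∑ i, I.c i, fun k hk => ?_⟩
  have hk' : (0 : ℝ) < k := by exact_mod_cast hk
  rw [averageValue_eq, div_le_iff₀ hk', add_mul, div_mul_cancel₀ _ hk'.ne']
  linarith [hD.expValue_le s₀ π k]

theorem ValidPrices.dualObjective_nonneg (hD : I.ValidPrices D) : 0 ≤ dualObjective M D :=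
  add_nonneg (mul_nonneg M.cast_nonneg hD.lam_nonneg) (sum_nonneg fun i _ => hD.h_nonneg i)

theorem ValidPrices.le_of_mem_achievableValues (hD : I.ValidPrices D) {w : ℝ}
    (hw : w ∈ I.achievableValues M) : w ≤ dualObjective M D := by
  obtain ⟨π, s₀, rfl⟩ := hw
  obtain ⟨C, hC⟩ := hD.exists_averageValue_le π s₀
  exact limsup_le_of_le_add_div hD.dualObjective_nonneg hC

theorem ValidPrices.optimalValue_le (hD : I.ValidPrices D) :
    I.optimalValue M ≤ dualObjective M D :=
  Real.sSup_le (fun _ hw => hD.le_of_mem_achievableValues hw) hD.dualObjective_nonneg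

theorem ValidPrices.le_guaranteedValue (hD : I.ValidPrices D) {π : Policy n M}
    {s₀ : Fin n → Bool} {κ C : ℝ} (h : ∀ k : ℕ, k * κ + C ≤ I.expValue s₀ π k []) :
    κ ≤ I.guaranteedValue π s₀ := by
  obtain ⟨C', hC'⟩ := hD.exists_averageValue_le π s₀
  refine le_liminf_of_add_div_le (C := C) (isBoundedUnder_of_le_add_div hC') fun k hk => ?_
  have hk' : (0 : ℝ) < k := by exact_mod_cast hk
  rw [averageValue_eq, le_div_iff₀ hk', add_mul, div_mul_cancel₀ _ hk'.ne', mul_comm]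
  exact h k

end ValidPrices

section UnboundedHorizon

/-- Dual prices for an unbounded horizon, made from a feasible point with horizon `T`. The increase
of `h` by `(c + p) / T` pays, over `T` steps, for all that a probe can cost. -/
def DualPoint.extend (I : ProbeBandit n) (T : ℕ) (D : DualPoint n) : DualPoint n where
  lam := D.lam
  h i := D.h i + (I.c i + D.p i) / T
  p := D.p
  φ i s t := max 0 (I.R i s t - D.lam)

theorem R_le_R_true (i : Fin n) (s : Bool) {t t' : ℕ} (h : t ≤ t') :
    I.R i s t' ≤ I.R i true t := by
  cases s
  exacts [I.R_false_le_R_true i t' t, I.R_true_anti i h]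

theorem DualFeasible.extend_φ_le (hD : I.DualFeasible M T D) (i : Fin n) (s : Bool) {t : ℕ}
    (ht : t ∈ Icc 1 T) : (D.extend I T).φ i s t ≤ D.φ i s t :=
  max_le (hD.φ_nonneg i s t ht) (sub_le_iff_le_add'.2 (hD.play i s t ht))

theorem DualFeasible.sum_extend_φ_le (hD : I.DualFeasible M T D) (i : Fin n) (s : Bool) {t : ℕ}
    (ht : t ≤ T) :
    ∑ l ∈ Icc 1 t, (D.extend I T).φ i s l ≤ t * D.h i + I.c i - I.gain i s t * D.p i := by
  have hφ : ∑ l ∈ Icc 1 t, (D.extend I T).φ i s l ≤ ∑ l ∈ Icc 1 t, D.φ i s l :=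
    sum_le_sum fun l hl => hD.extend_φ_le i s (Icc_subset_Icc_right ht hl)
  have hslack := hD.probeSlack_nonneg i s ht
  rw [probeSlack] at hslack
  linarith

theorem DualPoint.mul_extend_h (I : ProbeBandit n) (hT : 1 ≤ T) (D : DualPoint n) (i : Fin n) :
    T * (D.extend I T).h i = T * D.h i + (I.c i + D.p i) := by
  have hT' : (T : ℝ) ≠ 0 := by positivity
  rw [extend, mul_add, mul_div_cancel₀ _ hT']

theorem DualFeasible.extend_φ_le_h (hD : I.DualFeasible M T D) (hT : 1 ≤ T) (i : Fin n)
    (s : Bool) {t : ℕ} (ht : T ≤ t) : (D.extend I T).φ i s t ≤ (D.extend I T).h i := by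
  have hT' : (0 : ℝ) < T := by exact_mod_cast hT
  have hmono : ∑ _l ∈ Icc 1 T, (D.extend I T).φ i s t ≤ ∑ l ∈ Icc 1 T, (D.extend I T).φ i true l :=
    sum_le_sum fun l hl => max_le_max le_rfl <| sub_le_sub_right
      (R_le_R_true i s ((mem_Icc.1 hl).2.trans ht)) _
  have hgood := hD.sum_extend_φ_le i true le_rfl
  have hp := mul_nonneg (I.goodProb_nonneg i true T) (hD.p_nonneg i)
  rw [sum_const, Nat.card_Icc, Nat.add_sub_cancel, nsmul_eq_mul] at hmono
  rw [gain, if_pos rfl, sub_mul] at hgood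
  refine le_of_mul_le_mul_left ?_ hT'
  rw [DualPoint.mul_extend_h I hT]
  linarith

theorem DualFeasible.p_le_ageValue_extend (hD : I.DualFeasible M T D) (hT : 1 ≤ T) (i : Fin n)
    (s : Bool) {t : ℕ} (ht : T ≤ t) : D.p i ≤ ageValue (D.extend I T) i s t := by
  induction t, ht using Nat.le_induction with
  | base =>
    have hsum := hD.sum_extend_φ_le i s le_rfl
    have hp := mul_nonneg (I.goodProb_nonneg i s T) (hD.p_nonneg i)
    rw [ageValue, DualPoint.mul_extend_h I hT, DualPoint.extend]
    cases s <;>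
      simp only [gain, DualPoint.extend, if_true, Bool.false_eq_true, if_false] at hsum ⊢ <;>
      linarith
  | succ t ht ih =>
    rw [ageValue_succ]
    linarith [hD.extend_φ_le_h hT i s (ht.trans t.le_succ)]

theorem DualFeasible.le_extend_h (hD : I.DualFeasible M T D) (i : Fin n) :
    D.h i ≤ (D.extend I T).h i :=
  le_add_of_nonneg_right (div_nonneg (add_nonneg (I.c_nonneg i) (hD.p_nonneg i)) T.cast_nonneg)

theorem DualFeasible.extend_probeSlack_nonneg (hD : I.DualFeasible M T D) (hT : 1 ≤ T)
    (i : Fin n) (s : Bool) (t : ℕ) : 0 ≤ I.probeSlack (D.extend I T) i s t := by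
  rcases le_total t T with ht | ht
  · have hh := mul_le_mul_of_nonneg_left (hD.le_extend_h i) (t.cast_nonneg (α := ℝ))
    have hsum := hD.sum_extend_φ_le i s ht
    have hp : (D.extend I T).p i = D.p i := rfl
    rw [probeSlack, hp]
    linarith
  · have hle := hD.p_le_ageValue_extend hT i s ht
    have hprob := mul_le_of_le_one_left (hD.p_nonneg i) (I.goodProb_le_one i s t)
    rw [ageValue_eq I, show (D.extend I T).p i = D.p i from rfl] at hle
    linarith [I.c_nonneg i]

theorem DualFeasible.validPrices_extend (hD : I.DualFeasible M T D) (hT : 1 ≤ T) :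
    I.ValidPrices (D.extend I T) where
  lam_nonneg := hD.lam_nonneg
  h_nonneg i := (hD.h_nonneg i).trans (hD.le_extend_h i)
  p_nonneg := hD.p_nonneg
  φ_nonneg _ _ _ := le_max_left _ _
  playSlack_nonneg _ _ _ := sub_nonneg.2 (sub_le_iff_le_add'.1 (le_max_right _ _))
  probeSlack_nonneg := hD.extend_probeSlack_nonneg hT

theorem bddAbove_achievableValues (I : ProbeBandit n) (M : ℕ) :
    BddAbove (I.achievableValues M) := by
  obtain ⟨D, hD⟩ := exists_dualFeasible I M 1
  exact ⟨_, fun _ hw => (hD.validPrices_extend le_rfl).le_of_mem_achievableValues hw⟩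

theorem DualFeasible.p_le (hD : I.DualFeasible M T D) (hT : 1 ≤ T) (i : Fin n) :
    D.p i ≤ (D.h i + I.c i) / I.α i := by
  have hmem : 1 ∈ Icc 1 T := mem_Icc.2 ⟨le_rfl, hT⟩
  have hbad := hD.bad i 1 hmem
  rw [v_one, Icc_self, sum_singleton, Nat.cast_one, one_mul] at hbad
  rw [le_div_iff₀ (I.α_pos i)]
  linarith [hD.φ_nonneg i false 1 hmem]

theorem DualFeasible.sum_c_add_p_le (hD : I.DualFeasible M T D) (hT : 1 ≤ T) :
    ∑ i, (I.c i + D.p i) ≤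
      (∑ i, 1 / I.α i) * (M * D.lam) + ∑ i, (I.c i + I.c i / I.α i) := by
  rw [hD.balance, mul_sum, ← sum_add_distrib]
  refine sum_le_sum fun i _ => ?_
  have hα : 1 / I.α i ≤ ∑ j, 1 / I.α j := single_le_sum (f := fun j => 1 / I.α j)
    (fun j _ => (one_div_pos.2 (I.α_pos j)).le) (mem_univ i)
  have hh := mul_le_mul_of_nonneg_right hα (hD.h_nonneg i)
  have hp := hD.p_le hT i
  rw [one_div_mul_eq_div] at hh
  rw [add_div] at hp
  linarith

theorem DualFeasible.mul_optimalValue_le (hD : I.DualFeasible M T D) (hT : 1 ≤ T) :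
    T * I.optimalValue M ≤ (2 * T + ∑ i, 1 / I.α i) * (M * D.lam) +
      ∑ i, (I.c i + I.c i / I.α i) := by
  have hT' : (0 : ℝ) ≤ T := T.cast_nonneg
  calc T * I.optimalValue M ≤ T * dualObjective M (D.extend I T) :=
        mul_le_mul_of_nonneg_left (hD.validPrices_extend hT).optimalValue_le hT'
    _ = 2 * T * (M * D.lam) + ∑ i, (I.c i + D.p i) := by
        rw [dualObjective, mul_add, mul_sum]
        simp only [DualPoint.mul_extend_h I hT, sum_add_distrib, ← mul_sum]
        rw [← hD.balance, DualPoint.extend]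
        ring
    _ ≤ _ := by linarith [hD.sum_c_add_p_le hT]

theorem exists_optimalValue_div_le (I : ProbeBandit n) (M : ℕ) {ε : ℝ} (hε : 0 < ε) :
    ∃ T₀ : ℕ, 1 ≤ T₀ ∧ ∀ T ≥ T₀, ∀ D, I.DualFeasible M T D →
      I.optimalValue M / (2 + ε) ≤ M * D.lam := by
  have hε2 : 0 < 2 + ε := by linarith
  rcases le_or_gt (I.optimalValue M) 0 with hopt | hopt
  · exact ⟨1, le_rfl, fun T _ D hD => (div_nonpos_of_nonpos_of_nonneg hopt hε2.le).trans
      (mul_nonneg M.cast_nonneg hD.lam_nonneg)⟩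
  set K := ∑ i, 1 / I.α i
  have hK : 0 ≤ K := sum_nonneg fun i _ => (one_div_pos.2 (I.α_pos i)).le
  set K' := ∑ i, (I.c i + I.c i / I.α i)
  obtain ⟨T₀, hT₀⟩ := exists_nat_gt
    ((K * I.optimalValue M + (2 + ε) * K') / (ε * I.optimalValue M))
  refine ⟨T₀ + 1, T₀.succ_pos, fun T hT D hD => ?_⟩
  have hlarge : K * I.optimalValue M + (2 + ε) * K' < T * (ε * I.optimalValue M) :=
    (div_lt_iff₀ (mul_pos hε hopt)).1 (hT₀.trans (by exact_mod_cast hT))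
  have hle := hD.mul_optimalValue_le (T₀.succ_pos.trans_le hT)
  by_contra! hlt
  rw [lt_div_iff₀ hε2] at hlt
  have hmul := mul_le_mul_of_nonneg_left hlt.le (show (0 : ℝ) ≤ 2 * T + K by positivity)
  have hle' := mul_le_mul_of_nonneg_left hle hε2.le
  linarith

end UnboundedHorizon

end ProbeBandit

namespace StageParams

variable {n : ℕ} {q : StageParams n} {s₀ : Fin n → Bool} {h : History n} {i : Fin n} {M : ℕ}

section StageInvariants

/-- How the age of an arm is related to its phase: an arm in a stage has been played in each step
of the stage and has not outlasted it. An arm can start Stage 1 later than it gets ready, hence the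
inequality for `trying`. -/
def StageInvariant (q : StageParams n) (s₀ : Fin n → Bool) (h : History n) (i : Fin n) : Prop :=
  match phase s₀ h i with
  | .waiting y => lastObs s₀ h i = false ∧ age h i = y
  | .trying j => lastObs s₀ h i = false ∧ q.d i - q.m i + j ≤ age h i ∧ j ≤ q.m i
  | .exploiting j => lastObs s₀ h i = true ∧ age h i = j ∧ j ≤ q.e i

theorem mem_busy_iff : i ∈ q.busy s₀ h ↔
    i ∈ q.S ∧ ∃ j, phase s₀ h i = .trying j ∨ phase s₀ h i = .exploiting j := by
  simp only [busy, mem_filter]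

theorem mem_ready_iff :
    i ∈ q.ready s₀ h ↔ i ∈ q.S ∧ ∃ y, phase s₀ h i = .waiting y ∧ q.d i - q.m i ≤ y := by
  simp only [ready, mem_filter]

theorem notMem_busy_of_waiting {y : ℕ} (hy : phase s₀ h i = .waiting y) : i ∉ q.busy s₀ h := by
  simp [mem_busy_iff, hy]

theorem mem_ready_iff_of_waiting {y : ℕ} (hy : phase s₀ h i = .waiting y) :
    i ∈ q.ready s₀ h ↔ i ∈ q.S ∧ q.d i - q.m i ≤ y := by
  simp [mem_ready_iff, hy]

theorem PlayRule.subset {A : Finset (Fin n)} (hA : q.PlayRule s₀ M h A) : A ⊆ q.S := by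
  intro i hi
  by_cases hb : i ∈ q.busy s₀ h
  · exact (mem_busy_iff.1 hb).1
  · exact (mem_ready_iff.1 (hA.2.1 i hi hb).1).1

theorem stageInvariant_nil : q.StageInvariant s₀ [] i := by
  simp only [StageInvariant, phase, lastObs, age]
  cases s₀ i <;> simp

theorem StageInvariant.probed (hi : q.StageInvariant s₀ h i) (a : Fin n) (g : Bool) :
    q.StageInvariant s₀ (.probed a g :: h) i := by
  by_cases hia : i = a
  · simp only [StageInvariant, phase, lastObs, age, if_pos hia]
    cases g <;> simp
  · simpa only [StageInvariant, phase, lastObs, age, if_neg hia] using hi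

theorem StageInvariant.played {A : Finset (Fin n)} (hi : q.StageInvariant s₀ h i) (hiS : i ∈ q.S)
    (hA : q.PlayRule s₀ M h A) (hdue : ¬ q.Due s₀ h i) :
    q.StageInvariant s₀ (.played A :: h) i := by
  unfold StageInvariant at hi ⊢
  simp only [phase, lastObs, age]
  cases hp : phase s₀ h i with
  | waiting y =>
    simp only [hp] at hi
    by_cases hiA : i ∈ A
    · obtain ⟨hready, hm⟩ := hA.2.1 i hiA (notMem_busy_of_waiting hp)
      have hy := ((mem_ready_iff_of_waiting hp).1 hready).2
      simp only [if_pos hiA]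
      exact ⟨hi.1, by omega, hm⟩
    · simp only [if_neg hiA]
      exact ⟨hi.1, by omega⟩
  | trying j =>
    simp only [hp] at hi ⊢
    have hj : j ≠ q.m i := fun hj => hdue ⟨hiS, .inl (hj ▸ hp)⟩
    exact ⟨hi.1, by omega, by omega⟩
  | exploiting j =>
    simp only [hp] at hi ⊢
    have hj : j ≠ q.e i := fun hj => hdue ⟨hiS, .inr (hj ▸ hp)⟩
    exact ⟨hi.1, by omega, by omega⟩

theorem StageInvariant.age_pos_of_due (hi : q.StageInvariant s₀ h i) (hd : 1 ≤ q.d i)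
    (he : 1 ≤ q.e i) (hdue : q.Due s₀ h i) : 0 < age h i := by
  unfold StageInvariant at hi
  rcases hdue.2 with hp | hp <;> simp only [hp] at hi <;> omega

theorem ProbeRule.mem (hr : q.ProbeRule s₀ M h (some i)) : i ∈ q.S :=
  hr.elim And.left fun hready => (mem_ready_iff.1 hready.1).1

theorem StageInvariant.age_pos_of_probeRule (hi : q.StageInvariant s₀ h i) (hd : 1 ≤ q.d i)
    (he : 1 ≤ q.e i) (hr : q.ProbeRule s₀ M h (some i)) : 0 < age h i := by
  rcases hr with hdue | ⟨hready, hm, -⟩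
  · exact hi.age_pos_of_due hd he hdue
  · obtain ⟨-, y, hp, hy⟩ := mem_ready_iff.1 hready
    simp only [StageInvariant, hp] at hi
    omega

end StageInvariants

section DecisionPoints

theorem card_age_eq_zero_probed (g : Bool) (hi : 0 < age h i) :
    #{j | age (.probed i g :: h) j = 0} = #{j | age h j = 0} + 1 := by
  have hinsert : ({j | age (.probed i g :: h) j = 0} : Finset (Fin n)) =
      insert i ({j | age h j = 0} : Finset (Fin n)) := by
    ext j
    by_cases hj : j = i <;> simp [age, hj]
  rw [hinsert, card_insert_of_notMem (by simpa using hi.ne')]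

/-- What holds at a decision point of an execution of the two-stage policy. The count of the arms
observed in the current time step shows that the probes run out only after all arms were
observed. -/
def DecisionInvariant (q : StageParams n) (s₀ : Fin n → Bool) (o : Option ℕ) (h : History n) :
    Prop :=
  (∀ i ∈ q.S, q.StageInvariant s₀ h i) ∧
    match o with
    | none => ∀ i, ¬ q.Due s₀ h i
    | some k => #{j | age h j = 0} + k = n

namespace DecisionInvariant

theorem start (he : ∀ i ∈ q.S, 1 ≤ q.e i) : q.DecisionInvariant s₀ none [] := by
  refine ⟨fun i _ => stageInvariant_nil, fun i hdue => ?_⟩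
  have hei := he i hdue.1
  rcases hdue.2 with hp | hp <;> simp only [phase] at hp <;> split_ifs at hp
  simp only [Phase.exploiting.injEq] at hp
  omega

theorem play {A : Finset (Fin n)} (hinv : q.DecisionInvariant s₀ none h)
    (hA : q.PlayRule s₀ M h A) : q.DecisionInvariant s₀ (some n) (.played A :: h) :=
  ⟨fun i hi => (hinv.1 i hi).played hi hA (hinv.2 i), by simp [age]⟩

theorem probe {k : ℕ} (hd : ∀ i ∈ q.S, 1 ≤ q.d i) (he : ∀ i ∈ q.S, 1 ≤ q.e i)
    (hinv : q.DecisionInvariant s₀ (some (k + 1)) h) (hr : q.ProbeRule s₀ M h (some i))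
    (g : Bool) : q.DecisionInvariant s₀ (some k) (.probed i g :: h) := by
  have hage := (hinv.1 i hr.mem).age_pos_of_probeRule (hd i hr.mem) (he i hr.mem) hr
  refine ⟨fun j hj => (hinv.1 j hj).probed i g, ?_⟩
  have hcard := hinv.2
  simp only [card_age_eq_zero_probed g hage] at hcard ⊢
  omega

theorem age_eq_zero (hinv : q.DecisionInvariant s₀ (some 0) h) (i : Fin n) : age h i = 0 := by
  have huniv : ({j | age h j = 0} : Finset (Fin n)) = univ :=
    eq_univ_of_card _ (hinv.2.trans (Fintype.card_fin n).symm)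
  exact (filter_eq_self.1 huniv) i (mem_univ i)

theorem last (hd : ∀ i ∈ q.S, 1 ≤ q.d i) (he : ∀ i ∈ q.S, 1 ≤ q.e i)
    (hinv : q.DecisionInvariant s₀ (some 0) h) : q.DecisionInvariant s₀ none h :=
  ⟨hinv.1, fun i hdue => ((hinv.1 i hdue.1).age_pos_of_due (hd i hdue.1) (he i hdue.1) hdue).ne'
    (hinv.age_eq_zero i)⟩

end DecisionInvariant

theorem decisionInvariant {π : Policy n M} (hd : ∀ i ∈ q.S, 1 ≤ q.d i) (he : ∀ i ∈ q.S, 1 ≤ q.e i)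
    (hπ : IsTwoStage q s₀ π) {o : Option ℕ} (hv : Visits π o h) : q.DecisionInvariant s₀ o h := by
  induction hv with
  | start => exact .start he
  | play hv hA ih => exact ih.play (hπ.1 _ hv _ hA)
  | probe good hv hp ih => exact ih.probe hd he (hπ.2 _ _ hv _ hp) good
  | finish hv hp ih => exact ⟨ih.1, hπ.2 _ _ hv _ hp⟩
  | last _ ih => exact ih.last hd he

end DecisionPoints

end StageParams

namespace ProbeBandit

variable {n : ℕ} {I : ProbeBandit n} {M : ℕ} {D : DualPoint n} {q : StageParams n}
  {s₀ : Fin n → Bool} {h : History n} {i : Fin n}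

section StageValues

/-- Potential of an arm in the two-stage policy, at the prices `D`: what the arm has still to earn
to bring `h` in each step outside the ready state and to pay `lam` for each play. -/
def stageValue (I : ProbeBandit n) (D : DualPoint n) (q : StageParams n) (i : Fin n) : Phase → ℝ
  | .waiting y => (min y (q.d i - q.m i) : ℕ) * D.h i
  | .trying j => (q.d i - q.m i + j : ℕ) * D.h i -
      ∑ l ∈ range j, (I.R i false (q.d i - q.m i + l + 1) - D.lam)
  | .exploiting j => D.p i + j * D.h i - ∑ l ∈ range j, (I.R i true (l + 1) - D.lam)

theorem stageValue_waiting_of_le {y : ℕ} (hy : q.d i - q.m i ≤ y) :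
    I.stageValue D q i (.waiting y) = I.stageValue D q i (.trying 0) := by
  simp [stageValue, min_eq_right hy]

theorem stageValue_waiting_succ {y : ℕ} (hy : y < q.d i - q.m i) :
    I.stageValue D q i (.waiting (y + 1)) = I.stageValue D q i (.waiting y) + D.h i := by
  rw [stageValue, stageValue, min_eq_left hy.le, min_eq_left hy]
  push_cast
  ring

theorem stageValue_trying_succ (j : ℕ) :
    I.stageValue D q i (.trying (j + 1)) = I.stageValue D q i (.trying j) + D.h i + D.lam -
      I.R i false (q.d i - q.m i + j + 1) := by
  rw [stageValue, stageValue, sum_range_succ]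
  push_cast
  ring

theorem stageValue_exploiting_succ (j : ℕ) :
    I.stageValue D q i (.exploiting (j + 1)) = I.stageValue D q i (.exploiting j) + D.h i +
      D.lam - I.R i true (j + 1) := by
  rw [stageValue, stageValue, sum_range_succ]
  push_cast
  ring

theorem TightStages.stageValue_trying_m (ht : I.TightStages D q i) :
    I.stageValue D q i (.trying (q.m i)) = -I.c i + I.v i (q.d i) * D.p i := by
  rw [stageValue, Nat.sub_add_cancel ht.m_le_d]
  linarith [ht.bad]

theorem TightStages.stageValue_exploiting_e (ht : I.TightStages D q i) :
    I.stageValue D q i (.exploiting (q.e i)) = -I.c i + I.u i (q.e i) * D.p i := by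
  rw [stageValue]
  linarith [ht.good]

theorem neg_sum_range_sub_le {lam : ℝ} (hlam : 0 ≤ lam) {f : ℕ → ℝ} (hf : ∀ l, 0 ≤ f l) {j N : ℕ}
    (hj : j ≤ N) : -∑ l ∈ range j, (f l - lam) ≤ N * lam := by
  rw [sum_sub_distrib, sum_const, card_range, nsmul_eq_mul]
  have hsum := sum_nonneg fun l (_ : l ∈ range j) => hf l
  have hmul : (j : ℝ) * lam ≤ N * lam := by gcongr
  linarith

theorem stageValue_le (hlam : 0 ≤ D.lam) (ht : I.TightStages D q i)
    (hinv : q.StageInvariant s₀ h i) :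
    I.stageValue D q i (phase s₀ h i) ≤ D.p i + (q.d i + q.e i) * (D.h i + D.lam) := by
  have hh := ht.h_nonneg
  have hp := ht.p_nonneg
  have hmono : ∀ {a b : ℕ}, a ≤ b → (a : ℝ) * D.h i ≤ b * D.h i := fun hab => by gcongr
  have hdh := mul_nonneg (q.d i).cast_nonneg hh
  have heh := mul_nonneg (q.e i).cast_nonneg hh
  have hdlam := mul_nonneg (q.d i).cast_nonneg hlam
  have helam := mul_nonneg (q.e i).cast_nonneg hlam
  have hmd := ht.m_le_d
  unfold StageParams.StageInvariant at hinv
  rcases hph : phase s₀ h i with y | j | j <;> simp only [hph] at hinv <;> rw [stageValue]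
  · have hy : min y (q.d i - q.m i) ≤ q.d i := (min_le_right _ _).trans (Nat.sub_le _ _)
    linarith [hmono hy]
  · have hj : q.d i - q.m i + j ≤ q.d i := by omega
    linarith [hmono hj, neg_sum_range_sub_le hlam
      (fun l => I.R_nonneg i false (q.d i - q.m i + l + 1)) (le_of_add_le_right hj)]
  · linarith [hmono hinv.2.2,
      neg_sum_range_sub_le hlam (fun l => I.R_nonneg i true (l + 1)) hinv.2.2]

theorem stageValue_le_of_probeRule (ht : I.TightStages D q i) (hinv : q.StageInvariant s₀ h i)
    (hr : q.ProbeRule s₀ M h (some i)) :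
    I.stageValue D q i (phase s₀ h i) ≤
      -I.c i + I.goodProb i (lastObs s₀ h i) (age h i) * D.p i := by
  have hmd := ht.m_le_d
  have htry : ∀ t, q.d i ≤ t →
      I.stageValue D q i (.trying (q.m i)) ≤ -I.c i + I.goodProb i false t * D.p i := by
    intro t hdt
    rw [ht.stageValue_trying_m]
    exact add_le_add_right (mul_le_mul_of_nonneg_right (I.v_mono i hdt) ht.p_nonneg) _
  unfold StageParams.StageInvariant at hinv
  rcases hr with ⟨-, hph | hph⟩ | ⟨hready, hm, -⟩
  · simp only [hph] at hinv
    rw [hph, hinv.1]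
    exact htry _ (by omega)
  · simp only [hph] at hinv
    rw [hph, hinv.1, hinv.2.1]
    exact ht.stageValue_exploiting_e.le
  · obtain ⟨-, y, hph, hy⟩ := StageParams.mem_ready_iff.1 hready
    simp only [hph] at hinv
    rw [hph, hinv.1, stageValue_waiting_of_le hy, ← hm]
    exact htry _ (by omega)

theorem stageValue_played_of_mem {A : Finset (Fin n)} (hinv : q.StageInvariant s₀ h i)
    (hA : q.PlayRule s₀ M h A) (hiA : i ∈ A) :
    I.stageValue D q i (phase s₀ h i) + D.lam + D.h i ≤
      I.R i (lastObs s₀ h i) (age h i + 1) +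
        I.stageValue D q i (phase s₀ (.played A :: h) i) := by
  unfold StageParams.StageInvariant at hinv
  have htry : ∀ j, q.d i - q.m i + j ≤ age h i →
      I.stageValue D q i (.trying j) + D.lam + D.h i ≤
        I.R i false (age h i + 1) + I.stageValue D q i (.trying (j + 1)) := by
    intro j hj
    rw [stageValue_trying_succ]
    linarith [I.R_false_mono i (Nat.succ_le_succ hj)]
  cases hph : phase s₀ h i with
  | waiting y =>
    simp only [hph] at hinv
    have hready := (hA.2.1 i hiA (StageParams.notMem_busy_of_waiting hph)).1
    have hy := ((StageParams.mem_ready_iff_of_waiting hph).1 hready).2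
    simp only [phase, hph, if_pos hiA, hinv.1, stageValue_waiting_of_le hy]
    exact htry 0 (by omega)
  | trying j =>
    simp only [hph] at hinv
    simp only [phase, hph, hinv.1]
    exact htry j hinv.2.1
  | exploiting j =>
    simp only [hph] at hinv
    simp only [phase, hph, hinv.1, hinv.2.1, stageValue_exploiting_succ]
    linarith

theorem stageValue_played_of_notMem {A : Finset (Fin n)} (hiS : i ∈ q.S)
    (hA : q.PlayRule s₀ M h A) (hiA : i ∉ A) :
    I.stageValue D q i (phase s₀ h i) + (if i ∈ q.ready s₀ h then 0 else D.h i) =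
      I.stageValue D q i (phase s₀ (.played A :: h) i) := by
  have hbusy : ∀ j, ¬ (phase s₀ h i = .trying j ∨ phase s₀ h i = .exploiting j) := fun j hj =>
    hiA (hA.1 (StageParams.mem_busy_iff.2 ⟨hiS, j, hj⟩))
  cases hph : phase s₀ h i with
  | trying j => exact (hbusy j (.inl hph)).elim
  | exploiting j => exact (hbusy j (.inr hph)).elim
  | waiting y =>
    simp only [phase, hph, if_neg hiA, StageParams.mem_ready_iff_of_waiting hph, hiS, true_and]
    split_ifs with hy
    · rw [stageValue_waiting_of_le hy, stageValue_waiting_of_le (hy.trans y.le_succ), add_zero]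
    · rw [stageValue_waiting_succ (not_le.1 hy)]

end StageValues

section TwoStageLowerBound

/-- Potential of all the arms of the two-stage policy. -/
def stagePotential (I : ProbeBandit n) (D : DualPoint n) (q : StageParams n) (s₀ : Fin n → Bool)
    (h : History n) : ℝ :=
  ∑ i ∈ q.S, I.stageValue D q i (phase s₀ h i)

theorem stagePotential_probed (hi : i ∈ q.S) (g : Bool) :
    I.stagePotential D q s₀ (.probed i g :: h) = (if g then D.p i else 0) +
      ∑ j ∈ q.S.erase i, I.stageValue D q j (phase s₀ h j) := by
  rw [stagePotential, ← add_sum_erase _ _ hi]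
  congr 1
  · cases g <;> simp [phase, stageValue]
  · refine sum_congr rfl fun j hj => ?_
    simp only [phase, if_neg (ne_of_mem_erase hj)]

theorem stagePotential_le_of_probeRule (ht : I.TightStages D q i)
    (hinv : q.StageInvariant s₀ h i) (hr : q.ProbeRule s₀ M h (some i)) :
    I.stagePotential D q s₀ h ≤
      -I.c i + ∑ g, I.probeProb s₀ h i g * I.stagePotential D q s₀ (.probed i g :: h) := by
  simp only [stagePotential_probed hr.mem, sum_probeProb_mul, if_true, Bool.false_eq_true, if_false]
  rw [stagePotential, ← add_sum_erase _ _ hr.mem]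
  linarith [stageValue_le_of_probeRule ht hinv hr]

/-- Either all `M` places are taken and the plays bring `M * lam`, or no ready arm is left over and
each arm brings `h`, which is `M * lam` in total by the balance of the prices. -/
theorem mul_lam_le_of_playRule {A : Finset (Fin n)} (hlam : 0 ≤ D.lam)
    (hh : ∀ i ∈ q.S, 0 ≤ D.h i) (hbal : M * D.lam = ∑ i ∈ q.S, D.h i)
    (hA : q.PlayRule s₀ M h A) (hcard : A.card ≤ M) :
    M * D.lam ≤ A.card * D.lam + ∑ i ∈ q.S, if i ∈ q.ready s₀ h \ A then 0 else D.h i := by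
  rcases hcard.eq_or_lt with hfull | hfree
  · rw [hfull]
    refine le_add_of_nonneg_right (sum_nonneg fun i hi => ?_)
    split_ifs
    exacts [le_rfl, hh i hi]
  · have hempty : q.ready s₀ h \ A = ∅ := sdiff_eq_empty_iff_subset.2 (hA.2.2 hfree)
    simp only [hempty, notMem_empty, if_false, hbal]
    exact le_add_of_nonneg_left (mul_nonneg A.card.cast_nonneg hlam)

theorem stagePotential_le_of_playRule {A : Finset (Fin n)} (hlam : 0 ≤ D.lam)
    (hh : ∀ i ∈ q.S, 0 ≤ D.h i) (hbal : M * D.lam = ∑ i ∈ q.S, D.h i)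
    (hinv : ∀ i ∈ q.S, q.StageInvariant s₀ h i) (hA : q.PlayRule s₀ M h A) (hcard : A.card ≤ M) :
    M * D.lam + I.stagePotential D q s₀ h ≤
      (∑ i ∈ A, I.R i (lastObs s₀ h i) (age h i + 1)) +
        I.stagePotential D q s₀ (.played A :: h) := by
  have harm : ∀ i ∈ q.S, I.stageValue D q i (phase s₀ h i) + (if i ∈ A then D.lam else 0) +
      (if i ∈ q.ready s₀ h \ A then 0 else D.h i) ≤
      (if i ∈ A then I.R i (lastObs s₀ h i) (age h i + 1) else 0) +
        I.stageValue D q i (phase s₀ (.played A :: h) i) := by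
    intro i hi
    by_cases hiA : i ∈ A
    · simpa [hiA] using stageValue_played_of_mem (hinv i hi) hA hiA
    · simpa [hiA] using (stageValue_played_of_notMem hi hA hiA).le
  have hsum := sum_le_sum harm
  simp only [sum_add_distrib, sum_ite_mem, inter_eq_right.2 hA.subset, sum_const,
    nsmul_eq_mul] at hsum
  have hrate := mul_lam_le_of_playRule hlam hh hbal hA hcard
  rw [stagePotential, stagePotential]
  linarith

theorem exists_le_expValue_of_isTwoStage {π : Policy n M} (hlam : 0 ≤ D.lam)
    (hbal : M * D.lam = ∑ i ∈ q.S, D.h i) (ht : ∀ i ∈ q.S, I.TightStages D q i)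
    (hπ : IsTwoStage q s₀ π) : ∃ C, ∀ k : ℕ, k * (M * D.lam) + C ≤ I.expValue s₀ π k [] := by
  have hinv : ∀ {o h}, Visits π o h → ∀ i ∈ q.S, q.StageInvariant s₀ h i := fun hv =>
    (StageParams.decisionInvariant (fun i hi => (ht i hi).one_le_d)
      (fun i hi => (ht i hi).one_le_e) hπ hv).1
  set K := ∑ i ∈ q.S, (D.p i + (q.d i + q.e i) * (D.h i + D.lam))
  refine ⟨I.stagePotential D q s₀ [] - K, fun k => ?_⟩
  have hpot := expValue_potential (I := I) (s₀ := s₀) (π := π) (σ := -1)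
    (F := I.stagePotential D q s₀) (M * D.lam) K ?play ?probe ?bound k [] .start
  case play =>
    intro h hv A hA
    linarith [stagePotential_le_of_playRule (I := I) hlam (fun i hi => (ht i hi).h_nonneg) hbal
      (hinv hv) (hπ.1 h hv A hA) (π.card_le h A hA)]
  case probe =>
    intro j h hv i hi
    have hr := hπ.2 j h hv _ hi
    linarith [stagePotential_le_of_probeRule (ht i hr.mem) (hinv hv i hr.mem) hr]
  case bound =>
    intro h hv
    have hle := sum_le_sum fun i hi => stageValue_le hlam (ht i hi) (hinv hv i hi)
    rw [stagePotential]
    linarith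
  linarith

end TwoStageLowerBound

end ProbeBandit

namespace StageParams

section Existence

variable {n M : ℕ} {q : StageParams n} {s₀ : Fin n → Bool} {h : History n} {i : Fin n}

/-- No arm is left that can start Stage 1 with a probe. If a time step ends only in this situation,
the next plays can be chosen: `PlayRule` then allows to play all ready arms as long as fewer than
`M` arms are played. -/
def ProbesExhausted (q : StageParams n) (s₀ : Fin n → Bool) (M : ℕ) (h : History n) : Prop :=
  (q.busy s₀ h).card < M → ∀ i ∈ q.ready s₀ h, 0 < q.m i

theorem exists_probeRule (q : StageParams n) (s₀ : Fin n → Bool) (M : ℕ) (h : History n) :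
    ∃ o, q.ProbeRule s₀ M h o ∧ (o = none → q.ProbesExhausted s₀ M h) := by
  by_cases hex : ∃ i, q.ProbeRule s₀ M h (some i)
  · obtain ⟨i, hi⟩ := hex
    exact ⟨some i, hi, nofun⟩
  · push Not at hex
    refine ⟨none, fun i hi => hex i (.inl hi), fun _ hlt i hi => ?_⟩
    exact Nat.pos_of_ne_zero fun hm => hex i (.inr ⟨hi, hm, hlt⟩)

theorem ProbesExhausted.exists_playRule (hex : q.ProbesExhausted s₀ M h)
    (hbusy : (q.busy s₀ h).card ≤ M) :
    ∃ A : Finset (Fin n), A.card ≤ M ∧ q.PlayRule s₀ M h A := by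
  let B := q.busy s₀ h ∪ {i ∈ q.ready s₀ h | 0 < q.m i}
  have hstart : ∀ A ⊆ B, ∀ i ∈ A, i ∉ q.busy s₀ h → i ∈ q.ready s₀ h ∧ 0 < q.m i := by
    intro A hA i hi hb
    simpa [B, hb] using hA hi
  rcases le_or_gt B.card M with hB | hB
  · refine ⟨B, hB, subset_union_left, hstart B le_rfl, fun hlt i hi => ?_⟩
    have hm := hex ((card_le_card subset_union_left).trans_lt hlt) i hi
    exact mem_union_right _ (mem_filter.2 ⟨hi, hm⟩)
  · obtain ⟨A, hbA, hAB, hA⟩ := exists_subsuperset_card_eq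
      (subset_union_left : q.busy s₀ h ⊆ B) hbusy hB.le
    exact ⟨A, hA.le, hbA, hstart A hAB, fun hlt => (hlt.ne hA).elim⟩

theorem card_busy_nil_le (hcard : #{i ∈ q.S | s₀ i = true} ≤ M) : (q.busy s₀ []).card ≤ M := by
  refine (card_le_card fun i hi => ?_).trans hcard
  obtain ⟨hS, j, hj⟩ := mem_busy_iff.1 hi
  refine mem_filter.2 ⟨hS, ?_⟩
  by_contra hs
  simp [phase, hs] at hj

theorem PlayRule.busy_played_subset {A : Finset (Fin n)} (hA : q.PlayRule s₀ M h A) :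
    q.busy s₀ (.played A :: h) ⊆ A := by
  intro i hi
  by_contra hiA
  obtain ⟨hS, j, hj⟩ := mem_busy_iff.1 hi
  cases hp : phase s₀ h i with
  | waiting y => simp [phase, hp, hiA] at hj
  | trying j => exact hiA (hA.1 (mem_busy_iff.2 ⟨hS, j, .inl hp⟩))
  | exploiting j => exact hiA (hA.1 (mem_busy_iff.2 ⟨hS, j, .inr hp⟩))

theorem ProbeRule.card_busy_probed_le (hr : q.ProbeRule s₀ M h (some i))
    (hbusy : (q.busy s₀ h).card ≤ M) (g : Bool) : (q.busy s₀ (.probed i g :: h)).card ≤ M := by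
  have hsub : q.busy s₀ (.probed i g :: h) ⊆ insert i (q.busy s₀ h) := by
    intro j hj
    by_cases hji : j = i
    · exact hji ▸ mem_insert_self _ _
    · simp only [mem_busy_iff, phase, if_neg hji] at hj
      exact mem_insert_of_mem (mem_busy_iff.2 hj)
  refine (card_le_card hsub).trans ?_
  rcases hr with ⟨hS, hp⟩ | ⟨-, -, hlt⟩
  · have hi : i ∈ q.busy s₀ h :=
      mem_busy_iff.2 ⟨hS, hp.elim (fun hp => ⟨_, .inl hp⟩) fun hp => ⟨_, .inr hp⟩⟩
    rwa [insert_eq_of_mem hi]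
  · exact (card_insert_le _ _).trans hlt

theorem probesExhausted_of_age_eq_zero (hd : ∀ i ∈ q.S, 1 ≤ q.d i)
    (hinv : ∀ i ∈ q.S, q.StageInvariant s₀ h i) (hage : ∀ i, age h i = 0) :
    q.ProbesExhausted s₀ M h := by
  intro _ i hi
  obtain ⟨hS, y, hp, hy⟩ := mem_ready_iff.1 hi
  have hwait := hinv i hS
  simp only [StageInvariant, hp, hage i] at hwait
  have := hd i hS
  omega

theorem decisionInvariant_and_card_busy_le {π : Policy n M} (hd : ∀ i ∈ q.S, 1 ≤ q.d i)
    (he : ∀ i ∈ q.S, 1 ≤ q.e i) (hcard : #{i ∈ q.S | s₀ i = true} ≤ M)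
    (hplay : ∀ h, (∃ A : Finset (Fin n), A.card ≤ M ∧ q.PlayRule s₀ M h A) →
      ∀ A ∈ (π.play h).support, q.PlayRule s₀ M h A)
    (hprobe : ∀ h, ∀ o ∈ (π.probe h).support,
      q.ProbeRule s₀ M h o ∧ (o = none → q.ProbesExhausted s₀ M h))
    {o : Option ℕ} (hv : Visits π o h) :
    q.DecisionInvariant s₀ o h ∧ (q.busy s₀ h).card ≤ M ∧
      (o = none → q.ProbesExhausted s₀ M h) := by
  induction hv with
  | start =>
    have hinv := DecisionInvariant.start (s₀ := s₀) he
    exact ⟨hinv, card_busy_nil_le hcard,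
      fun _ => probesExhausted_of_age_eq_zero hd hinv.1 fun _ => rfl⟩
  | play _ hA ih =>
    have hr := hplay _ ((ih.2.2 rfl).exists_playRule ih.2.1) _ hA
    exact ⟨ih.1.play hr, (card_le_card hr.busy_played_subset).trans (π.card_le _ _ hA), nofun⟩
  | probe good _ hp ih =>
    have hr := (hprobe _ _ hp).1
    exact ⟨ih.1.probe hd he hr good, hr.card_busy_probed_le ih.2.1 good, nofun⟩
  | finish _ hp ih =>
    exact ⟨⟨ih.1.1, (hprobe _ _ hp).1⟩, ih.2.1, fun _ => (hprobe _ _ hp).2 rfl⟩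
  | last _ ih =>
    exact ⟨ih.1.last hd he, ih.2.1,
      fun _ => probesExhausted_of_age_eq_zero hd ih.1.1 ih.1.age_eq_zero⟩

theorem exists_isTwoStage (hd : ∀ i ∈ q.S, 1 ≤ q.d i) (he : ∀ i ∈ q.S, 1 ≤ q.e i)
    (hcard : #{i ∈ q.S | s₀ i = true} ≤ M) : ∃ π : Policy n M, IsTwoStage q s₀ π := by
  have hplays : ∀ h, ∃ A : Finset (Fin n), A.card ≤ M ∧
      ((∃ A : Finset (Fin n), A.card ≤ M ∧ q.PlayRule s₀ M h A) → q.PlayRule s₀ M h A) := by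
    intro h
    by_cases hex : ∃ A : Finset (Fin n), A.card ≤ M ∧ q.PlayRule s₀ M h A
    · exact hex.imp fun A hA => ⟨hA.1, fun _ => hA.2⟩
    · exact ⟨∅, by simp, fun h => (hex h).elim⟩
  choose A hAcard hA using hplays
  choose o ho using q.exists_probeRule s₀ M
  let π : Policy n M := ⟨fun h => PMF.pure (A h), fun h => PMF.pure (o h), fun h B hB => by
    rw [PMF.mem_support_pure_iff] at hB
    exact hB ▸ hAcard h⟩
  have hplay : ∀ h, (∃ A : Finset (Fin n), A.card ≤ M ∧ q.PlayRule s₀ M h A) →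
      ∀ A ∈ (π.play h).support, q.PlayRule s₀ M h A := by
    intro h hex B hB
    rw [PMF.mem_support_pure_iff] at hB
    exact hB ▸ hA h hex
  have hprobe : ∀ h, ∀ o ∈ (π.probe h).support,
      q.ProbeRule s₀ M h o ∧ (o = none → q.ProbesExhausted s₀ M h) := by
    intro h o' ho'
    rw [PMF.mem_support_pure_iff] at ho'
    exact ho' ▸ ho h
  refine ⟨π, fun h hv => hplay h ?_, fun _ h _ o' ho' => (hprobe h o' ho').1⟩
  obtain ⟨-, hbusy, hex⟩ := decisionInvariant_and_card_busy_le hd he hcard hplay hprobe hv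
  exact (hex rfl).exists_playRule hbusy

end Existence

end StageParams

end

theorem mainTheorem9 {n : ℕ} (I : ProbeBandit n) (M : ℕ) (hM : 1 ≤ M) (ε : ℝ) (hε : 0 < ε) :
    BddAbove (I.achievableValues M) ∧
    ∃ T₀ : ℕ, ∀ T ≥ T₀,
      (∃ P, I.PrimalOptimal M T P) ∧ (∃ D, I.DualOptimal M T D) ∧
      ∀ (P : ProbeBandit.PrimalPoint n) (D : ProbeBandit.DualPoint n),
        I.PrimalOptimal M T P → I.DualOptimal M T D →
        (∀ i, 0 < D.h i →
          (∃ t ∈ Finset.Icc 1 T, 0 < P.z i true t) ∧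
          (∃ t ∈ Finset.Icc 1 T, 0 < P.z i false t)) ∧
        ∀ s₀ : Fin n → Bool, Finset.card {i | 0 < D.h i ∧ s₀ i = true} ≤ M →
          (∃ π : Policy n M, IsTwoStage (stageParams T P D) s₀ π) ∧
          ∀ π : Policy n M, IsTwoStage (stageParams T P D) s₀ π →
            I.optimalValue M / (2 + ε) ≤ I.guaranteedValue π s₀ := by
  obtain ⟨T₀, hT₀, hopt⟩ := ProbeBandit.exists_optimalValue_div_le I M hε
  refine ⟨ProbeBandit.bddAbove_achievableValues I M, T₀, fun T hT => ⟨I.exists_primalOptimal M T,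
    I.exists_dualOptimal M T, fun P D hP hD => ⟨fun i hi =>
      ⟨ProbeBandit.exists_z_pos hP hD hi true, ProbeBandit.exists_z_pos hP hD hi false⟩,
    fun s₀ hs₀ => ?_⟩⟩⟩
  have htight : ∀ i ∈ (stageParams T P D).S, I.TightStages D (stageParams T P D) i :=
    fun i hi => ProbeBandit.tightStages hP hD (mem_filter.1 hi).2
  refine ⟨StageParams.exists_isTwoStage (fun i hi => (htight i hi).one_le_d)
    (fun i hi => (htight i hi).one_le_e) ?_, fun π hπ => ?_⟩
  · simpa only [stageParams, filter_filter] using hs₀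
  · have hbalance : M * D.lam = ∑ i ∈ (stageParams T P D).S, D.h i := by
      rw [hD.1.balance]
      exact (sum_filter_of_ne fun i _ hne => (hD.1.h_nonneg i).lt_of_ne' hne).symm
    obtain ⟨C, hC⟩ :=
      ProbeBandit.exists_le_expValue_of_isTwoStage hD.1.lam_nonneg hbalance htight hπ
    exact (hopt T hT D hD.1).trans
      ((hD.1.validPrices_extend (hT₀.trans hT)).le_guaranteedValue hC)
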